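/- **Setting.** Consider the plant $\dot x = Ax+Bu+B_ww$, $z = Cx+Du+D_ww$ with $x\in\mathbb R^n$, $u\in\mathbb R^m$, $z\in\mathbb R^r$, $A$ Hurwitz, and a constant exogenous signal $w\in\mathcal W\subset\mathbb R^{n_w}$, where $\mathcal W$ is convex and compact. Put $G_u=-CA^{-1}B+D$ and $G_w=-CA^{-1}B_w+D_w$. For $w\in\mathcal W$ consider the steady-state problem $$\min_{\bar u\in\mathcal U,\ \bar z\in\mathcal Z}\ f_0(\bar u)+g_0(\bar z)\quad\text{s.t.}\quad \bar z=G_u\bar u+G_ww,\qquad 0=H_z\bar z+H_u\bar u+H_ww, \tag{1}$$ with $H_w\in\mathbb R^{n_c\times n_w}$, $\mathcal U\subseteq\mathbb R^m$ and $\mathcal Z\subseteq\mathbb R^r$ convex, $f_0:\mathcal U\to\mathbb R$ and $g_0:\mathcal Z\to\mathbb R$ convex, and continuously differentiable with locally Lipschitz gradients on $\operatorname{int}\mathcal U$ and $\operatorname{int}\mathcal Z$ respectively. Assume that for every $w\in\mathcal W$ problem (1) has an optimal solution $(\bar u,\bar z)$ with $\bar u\in\operatorname{int}\mathcal U$ and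 $\bar z\in\operatorname{int}\mathcal Z$ (in particular (1) is strictly feasible). The plant output $z(t)$ and the constraint violation $H_zz(t)+H_uu(t)+H_ww$ are available to the controller. A controller *solves the optimal steady-state (OSS) problem* if for every $w\in\mathcal W$ the closed-loop system has exactly one equilibrium, this equilibrium is locally exponentially stable, and the values $(\bar u,\bar z)$ of input and output at the equilibrium are an optimal solution of (1). For $\tau_p,\tau_d>0$ the *primal-dual controller* is $$\tau_p\dot u=-\nabla f_0(u)-G_u^{\mathsf T}\nabla g_0(z)-(H_zG_u+H_u)^{\mathsf T}\mu,\qquad \tau_d\dot\mu=H_zz+H_uu+H_ww,$$ with $\mu\in\mathbb R^{n_c}$; the closed loop is considered on the set of states with $u\in\operatorname{int}\mathcal U$, $z\in\operatorname{int}\mathcal Z$. **Proposition (Primal-Dual).** Assume that, for some $\kappa>0$ and for every $w\in\mathcal W$, the function $u\mapsto f_0(u)+g_0(G_uu+G_ww)$ is strongly convex with modulus $\kappa$ on $\{u\in\mathcal U: G_uu+G_ww\in\mathcal Z\}$, and that $H_zG_u+H_u$ has full row rank. Then there exists $\tau^\star>0$ such that for all $\tau_p>\tau^\star$ and all $\tau_d>\tau^\star$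 the primal-dual controller solves the OSS problem. -/

import Mathlib

namespace OSS

/-- Euclidean space `ℝᵏ`. -/
abbrev Vec (k : ℕ) : Type := EuclideanSpace ℝ (Fin k)

/-- The action `v ↦ M v` of a real matrix on column vectors. -/
noncomputable def act {k l : ℕ} (M : Matrix (Fin k) (Fin l) ℝ) (v : Vec l) : Vec k :=
  Matrix.toEuclideanLin M v

/-- A real square matrix is Hurwitz if all its complex eigenvalues lie in the open left
half-plane. -/
def IsHurwitz {n : ℕ} (A : Matrix (Fin n) (Fin n) ℝ) : Prop :=
  ∀ s ∈ spectrum ℂ (A.map Complex.ofReal), s.re < 0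

/-- `ζ` is a solution on the time set `I` of the autonomous equation `ζ' = F ζ` posed on the
domain `D`. -/
def IsSolutionOn {X : Type*} [NormedAddCommGroup X] [NormedSpace ℝ X]
    (F : X → X) (D : Set X) (ζ : ℝ → X) (I : Set ℝ) : Prop :=
  (∀ t ∈ I, ζ t ∈ D) ∧ IsIntegralCurveOn ζ (fun _ => F) I

/-- `p` is an equilibrium of `ζ' = F ζ` on `D`. -/
def IsEquilibrium {X : Type*} [NormedAddCommGroup X] [NormedSpace ℝ X]
    (F : X → X) (D : Set X) (p : X) : Prop :=
  p ∈ D ∧ F p = 0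

/-- `p` is a locally exponentially stable equilibrium of `ζ' = F ζ` on `D`: from every initial
state near `p` there is a solution for all forward times, and every forward solution from there,
on whatever time interval, converges to `p` at a uniform exponential rate. -/
def IsLocallyExpStable {X : Type*} [NormedAddCommGroup X] [NormedSpace ℝ X]
    (F : X → X) (D : Set X) (p : X) : Prop :=
  IsEquilibrium F D p ∧
    ∃ δ > 0, ∃ c > 0, ∃ rate > 0, ∀ ζ₀ : X, ‖ζ₀ - p‖ < δ →
      (∃ ζ : ℝ → X, ζ 0 = ζ₀ ∧ IsSolutionOn F D ζ (Set.Ici 0)) ∧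
      ∀ (T : ℝ) (ζ : ℝ → X), ζ 0 = ζ₀ → IsSolutionOn F D ζ (Set.Ico 0 T) →
        ∀ t ∈ Set.Ico 0 T, ‖ζ t - p‖ ≤ c * Real.exp (-rate * t) * ‖ζ₀ - p‖

/-- The data of an optimal steady-state control problem: the plant
`x' = A x + B u + B_w w`, `z = C x + D u + D_w w`, the set `W` of disturbances, the objective
`f₀(u) + g₀(z)` with domains `U` and `Z`, and the engineering constraint
`0 = H_z z + H_u u + H_w w`. Only the values of `f₀` on `U` and of `g₀` on `Z` matter. -/
structure Problem (n m r nw nc : ℕ) where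
  A : Matrix (Fin n) (Fin n) ℝ
  B : Matrix (Fin n) (Fin m) ℝ
  Bw : Matrix (Fin n) (Fin nw) ℝ
  C : Matrix (Fin r) (Fin n) ℝ
  D : Matrix (Fin r) (Fin m) ℝ
  Dw : Matrix (Fin r) (Fin nw) ℝ
  Hz : Matrix (Fin nc) (Fin r) ℝ
  Hu : Matrix (Fin nc) (Fin m) ℝ
  Hw : Matrix (Fin nc) (Fin nw) ℝ
  W : Set (Vec nw)
  U : Set (Vec m)
  Z : Set (Vec r)
  f₀ : Vec m → ℝ
  g₀ : Vec r → ℝ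

namespace Problem

variable {n m r nw nc : ℕ}

/-- The DC gain from `u` to `z`. -/
noncomputable def Gu (P : Problem n m r nw nc) : Matrix (Fin r) (Fin m) ℝ :=
  -P.C * P.A⁻¹ * P.B + P.D

/-- The DC gain from `w` to `z`. -/
noncomputable def Gw (P : Problem n m r nw nc) : Matrix (Fin r) (Fin nw) ℝ :=
  -P.C * P.A⁻¹ * P.Bw + P.Dw

/-- The right-hand side of the state equation. -/
noncomputable def stateField (P : Problem n m r nw nc) (w : Vec nw) (x : Vec n) (u : Vec m) :
    Vec n :=
  act P.A x + act P.B u + act P.Bw w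

/-- The plant output `z = C x + D u + D_w w`. -/
noncomputable def plantOutput (P : Problem n m r nw nc) (w : Vec nw) (x : Vec n) (u : Vec m) :
    Vec r :=
  act P.C x + act P.D u + act P.Dw w

/-- The steady-state output `G_u u + G_w w`. -/
noncomputable def steadyOutput (P : Problem n m r nw nc) (w : Vec nw) (u : Vec m) : Vec r :=
  act P.Gu u + act P.Gw w

/-- The violation `H_z z + H_u u + H_w w` of the engineering constraint. -/
noncomputable def violation (P : Problem n m r nw nc) (w : Vec nw) (u : Vec m) (z : Vec r) :
    Vec nc :=
  act P.Hz z + act P.Hu u + act P.Hw w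

/-- Feasible points of the steady-state optimization problem. -/
def IsFeasible (P : Problem n m r nw nc) (w : Vec nw) (u : Vec m) (z : Vec r) : Prop :=
  u ∈ P.U ∧ z ∈ P.Z ∧ z = P.steadyOutput w u ∧ P.violation w u z = 0

/-- Optimal points of the steady-state optimization problem. -/
def IsOptimal (P : Problem n m r nw nc) (w : Vec nw) (u : Vec m) (z : Vec r) : Prop :=
  P.IsFeasible w u z ∧
    ∀ u' z', P.IsFeasible w u' z' → P.f₀ u + P.g₀ z ≤ P.f₀ u' + P.g₀ z'

/-- The standing assumptions. The interior optimal point in `optimal` makes the problem strictly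
feasible. -/
structure Standing (P : Problem n m r nw nc) : Prop where
  hurwitz : IsHurwitz P.A
  compact_W : IsCompact P.W
  convex_W : Convex ℝ P.W
  convex_f₀ : ConvexOn ℝ P.U P.f₀
  convex_g₀ : ConvexOn ℝ P.Z P.g₀
  contDiff_f₀ : ContDiffOn ℝ 1 P.f₀ (interior P.U)
  contDiff_g₀ : ContDiffOn ℝ 1 P.g₀ (interior P.Z)
  locLip_f₀ : LocallyLipschitzOn (interior P.U) (gradient P.f₀)
  locLip_g₀ : LocallyLipschitzOn (interior P.Z) (gradient P.g₀)
  optimal : ∀ w ∈ P.W, ∃ u ∈ interior P.U, ∃ z ∈ interior P.Z, P.IsOptimal w u z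

end Problem

/-- A dynamic output-feedback controller with state space `X`, `u = output ξ`,
`ξ' = field ξ z ε`, whose inputs are the measurements `z` (plant output) and `ε` (violation of the
engineering constraint); `field` is meaningful for `(ξ, z) ∈ dom`. The disturbance is not
available to it. -/
structure Controller (m r nc : ℕ) (X : Type*) where
  dom : Set (X × Vec r)
  field : X → Vec r → Vec nc → X
  output : X → Vec m

namespace Controller

variable {n m r nw nc : ℕ} {X : Type*}

/-- The plant output in the closed-loop state `(x, ξ)`. -/
noncomputable def loopOutput (K : Controller m r nc X) (P : Problem n m r nw nc) (w : Vec nw)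
    (s : Vec n × X) : Vec r :=
  P.plantOutput w s.1 (K.output s.2)

/-- The states `(x, ξ)` in which the closed loop is defined. -/
def loopDomain (K : Controller m r nc X) (P : Problem n m r nw nc) (w : Vec nw) :
    Set (Vec n × X) :=
  {s | (s.2, K.loopOutput P w s) ∈ K.dom}

/-- The closed-loop vector field. -/
noncomputable def loopField (K : Controller m r nc X) (P : Problem n m r nw nc) (w : Vec nw)
    (s : Vec n × X) : Vec n × X :=
  (P.stateField w s.1 (K.output s.2),
    K.field s.2 (K.loopOutput P w s) (P.violation w (K.output s.2) (K.loopOutput P w s)))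

/-- The controller solves the optimal steady-state control problem: for every `w ∈ W` the closed
loop has exactly one equilibrium, this equilibrium is locally exponentially stable, and the input
and output in equilibrium are optimal. -/
def SolvesOSS [NormedAddCommGroup X] [NormedSpace ℝ X]
    (K : Controller m r nc X) (P : Problem n m r nw nc) : Prop :=
  ∀ w ∈ P.W, ∃ p : Vec n × X,
    IsLocallyExpStable (K.loopField P w) (K.loopDomain P w) p ∧
    (∀ q, IsEquilibrium (K.loopField P w) (K.loopDomain P w) q → q = p) ∧
    P.IsOptimal w (K.output p.2) (K.loopOutput P w p)

end Controller

/-- The primal-dual controller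
`τ_p u' = -∇f₀(u) - G_uᵀ ∇g₀(z) - (H_z G_u + H_u)ᵀ μ`, `τ_d μ' = H_z z + H_u u + H_w w`,
with state `(u, μ)`, defined where the two gradients are. -/
noncomputable def primalDual {n m r nw nc : ℕ} (P : Problem n m r nw nc) (τp τd : ℝ) :
    Controller m r nc (Vec m × Vec nc) where
  dom := {q | q.1.1 ∈ interior P.U ∧ q.2 ∈ interior P.Z}
  field := fun ξ z ε =>
    (τp⁻¹ • (-gradient P.f₀ ξ.1 - act P.Gu.transpose (gradient P.g₀ z)
        - act (P.Hz * P.Gu + P.Hu).transpose ξ.2),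
      τd⁻¹ • ε)
  output := fun ξ => ξ.1

end OSS

/-!
The equilibria of the closed loop are the steady states belonging to the Karush-Kuhn-Tucker points
of the steady-state problem; strong convexity and surjectivity of the constraint operator
`M = H_z G_u + H_u` make the Karush-Kuhn-Tucker point unique.

For stability, let `e = (x, u, μ)` be the deviation from equilibrium and `y = x + A⁻¹ B u` the
deviation of the plant from the steady state for its current input. Large time constants make the
controller slow compared with the plant, so `y` is a small perturbation of the static primal-dual
flow. With `Θ` a Lyapunov operator for `A`, the quadratic form
`τ_p ⟪Θ y, y⟫ + τ_p/2 ‖u‖² + τ_d/2 ‖μ‖² + c min(τ_p, τ_d) ⟪M u, μ⟫` is a Lyapunov function: the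
plant dissipates in `y`, the strong monotonicity of the gradient in `u`, and for small `c` the cross
term in `μ`, through the coercivity of `M M*`.

The threshold for the time constants depends on Lipschitz constants of the gradients near the
optimal points. It can be chosen uniformly in `w`, because the optimal input depends continuously on
`w` and `W` is compact.
-/

namespace OSS

open Set Filter Topology Metric
open scoped NNReal ENNReal RealInnerProductSpace Gradient

section Flow

variable {X : Type*} [NormedAddCommGroup X] [NormedSpace ℝ X]

/-- The radial retraction onto the closed ball of radius `r` around `p`, used to extend a vector
field from that ball to the whole space. -/
noncomputable def radialRetraction (p : X) (r : ℝ) (s : X) : X :=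
  p + (r / max r ‖s - p‖) • (s - p)

lemma radialRetraction_mem_closedBall {r : ℝ} (hr : 0 < r) (p s : X) :
    radialRetraction p r s ∈ closedBall p r := by
  have hmax : 0 < max r ‖s - p‖ := lt_max_of_lt_left hr
  rw [mem_closedBall, dist_eq_norm, radialRetraction, add_sub_cancel_left, norm_smul,
    Real.norm_of_nonneg (by positivity), div_mul_eq_mul_div, div_le_iff₀ hmax]
  gcongr
  exact le_max_right _ _

lemma radialRetraction_of_mem {p s : X} {r : ℝ} (hr : 0 < r) (hs : s ∈ closedBall p r) :
    radialRetraction p r s = s := by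
  rw [mem_closedBall, dist_eq_norm] at hs
  rw [radialRetraction, max_eq_left hs, div_self hr.ne', one_smul, add_sub_cancel]

lemma lipschitzWith_radialRetraction {r : ℝ} (hr : 0 < r) (p : X) :
    LipschitzWith 2 (radialRetraction p r) := by
  refine LipschitzWith.of_dist_le_mul fun s t => ?_
  set a := max r ‖s - p‖
  set b := max r ‖t - p‖
  have ha : 0 < a := lt_max_of_lt_left hr
  have hb : 0 < b := lt_max_of_lt_left hr
  have hra : r / a ≤ 1 := (div_le_one ha).2 (le_max_left _ _)
  have htb : ‖t - p‖ / b ≤ 1 := (div_le_one hb).2 (le_max_right _ _)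
  have hab : |b - a| ≤ ‖s - t‖ := by
    calc |b - a| ≤ |‖t - p‖ - ‖s - p‖| := by
          simpa using abs_max_sub_max_le_max r ‖t - p‖ r ‖s - p‖
      _ ≤ ‖t - p - (s - p)‖ := abs_norm_sub_norm_le _ _
      _ = ‖s - t‖ := by rw [sub_sub_sub_cancel_right, norm_sub_rev]
  have hcoef : |r / a - r / b| * ‖t - p‖ = |b - a| * (r / a * (‖t - p‖ / b)) := by
    rw [show r / a - r / b = (b - a) * (r / (a * b)) by field_simp, abs_mul,
      abs_of_pos (a := r / (a * b)) (by positivity)]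
    field_simp
  have hsplit : radialRetraction p r s - radialRetraction p r t
      = (r / a) • (s - t) + (r / a - r / b) • (t - p) := by
    simp only [radialRetraction]
    module
  rw [dist_eq_norm, dist_eq_norm, hsplit, NNReal.coe_ofNat]
  calc ‖(r / a) • (s - t) + (r / a - r / b) • (t - p)‖
      ≤ r / a * ‖s - t‖ + |r / a - r / b| * ‖t - p‖ := by
        refine (norm_add_le _ _).trans_eq ?_
        rw [norm_smul, norm_smul, Real.norm_of_nonneg (by positivity), Real.norm_eq_abs]
    _ ≤ 1 * ‖s - t‖ + ‖s - t‖ * (1 * 1) := by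
        rw [hcoef]
        gcongr
    _ = 2 * ‖s - t‖ := by ring

lemma exists_bounded_lipschitzWith_eqOn_closedBall {F : X → X} {p : X} {r : ℝ} (hr : 0 < r)
    {K : ℝ≥0} (hF : LipschitzOnWith K F (closedBall p r)) :
    ∃ (G : X → X) (L K' : ℝ≥0), EqOn G F (closedBall p r) ∧ (∀ s, ‖G s‖ ≤ L) ∧
      LipschitzWith K' G := by
  have hmem := radialRetraction_mem_closedBall hr p
  refine ⟨F ∘ radialRetraction p r, ‖F p‖₊ + K * r.toNNReal, K * 2, fun s hs => ?_, fun s => ?_,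
    ?_⟩
  · rw [Function.comp_apply, radialRetraction_of_mem hr hs]
  · have hdist := hF.norm_sub_le (hmem s) (mem_closedBall_self hr.le)
    have hrad := mem_closedBall.1 (hmem s)
    rw [dist_eq_norm] at hrad
    rw [NNReal.coe_add, NNReal.coe_mul, Real.coe_toNNReal r hr.le, coe_nnnorm]
    calc ‖F (radialRetraction p r s)‖
        ≤ ‖F p‖ + ‖F (radialRetraction p r s) - F p‖ := norm_le_norm_add_norm_sub' _ _
      _ ≤ ‖F p‖ + K * ‖radialRetraction p r s - p‖ := by gcongr
      _ ≤ ‖F p‖ + K * r := by gcongr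
  · exact lipschitzOnWith_univ.1
      (hF.comp (lipschitzWith_radialRetraction hr p).lipschitzOnWith fun s _ => hmem s)

lemma exists_isIntegralCurveOn_Icc [CompleteSpace X] {G : X → X} {L K : ℝ≥0}
    (hL : ∀ s, ‖G s‖ ≤ L) (hK : LipschitzWith K G) (s₀ : X) {T : ℝ} (hT : 0 ≤ T) :
    ∃ ζ : ℝ → X, ζ 0 = s₀ ∧ IsIntegralCurveOn ζ (fun _ => G) (Icc 0 T) := by
  have hPL : IsPicardLindelof (fun _ : ℝ => G) (tmin := 0) (tmax := T) ⟨0, left_mem_Icc.2 hT⟩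
      s₀ (L * T.toNNReal) 0 L K :=
    IsPicardLindelof.of_time_independent (fun x _ => hL x) hK.lipschitzOnWith (by simp [hT])
  exact hPL.exists_eq_forall_mem_Icc_hasDerivWithinAt₀

lemma hasDerivWithinAt_Ici_of_isIntegralCurveOn_Icc {v : ℝ → X → X} {ζ : ℝ → X} {a b t : ℝ}
    (hζ : IsIntegralCurveOn ζ v (Icc a b)) (ht : t ∈ Ico a b) :
    HasDerivWithinAt ζ (v t (ζ t)) (Ici t) t :=
  (hζ t (Ico_subset_Icc_self ht)).mono_of_mem_nhdsWithin
    (mem_of_superset (Icc_mem_nhdsGE ht.2) (Icc_subset_Icc_left ht.1))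

lemma exists_isIntegralCurveOn_Ici_of_forall_Icc {G : X → X} {K : ℝ≥0} (hK : LipschitzWith K G)
    {s₀ : X} (hex : ∀ N : ℕ, ∃ ζ : ℝ → X, ζ 0 = s₀ ∧
      IsIntegralCurveOn ζ (fun _ => G) (Icc 0 (N : ℝ))) :
    ∃ ζ : ℝ → X, ζ 0 = s₀ ∧ IsIntegralCurveOn ζ (fun _ => G) (Ici 0) := by
  choose α hα₀ hα using hex
  have hagree : ∀ N N' : ℕ, N ≤ N' → EqOn (α N) (α N') (Icc 0 (N : ℝ)) := by
    intro N N' h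
    have hα' := (hα N').mono (Icc_subset_Icc_right (Nat.cast_le.2 h))
    exact ODE_solution_unique (v := fun _ => G) (fun _ => hK) (hα N).continuousOn
      (fun t ht => hasDerivWithinAt_Ici_of_isIntegralCurveOn_Icc (hα N) ht) hα'.continuousOn
      (fun t ht => hasDerivWithinAt_Ici_of_isIntegralCurveOn_Icc hα' ht) (by rw [hα₀, hα₀])
  have hlt : ∀ t : ℝ, t < (⌈t⌉₊ + 1 : ℕ) := fun t => by
    push_cast
    linarith [Nat.le_ceil t]
  refine ⟨fun t => α (⌈t⌉₊ + 1) t, hα₀ _, fun t (ht : 0 ≤ t) => ?_⟩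
  set N := ⌈t⌉₊ + 1
  have hglue : ∀ s ∈ Icc 0 (N : ℝ), α (⌈s⌉₊ + 1) s = α N s := fun s hs => by
    rcases le_total (⌈s⌉₊ + 1) N with h | h
    · exact hagree _ _ h ⟨hs.1, (hlt s).le⟩
    · exact (hagree _ _ h hs).symm
  have htN : t ∈ Icc 0 (N : ℝ) := ⟨ht, (hlt t).le⟩
  refine ((hα N t htN).congr hglue (hglue t htN)).mono_of_mem_nhdsWithin ?_
  rw [← Ici_inter_Iic]
  exact inter_mem_nhdsWithin _ (Iic_mem_nhds (hlt t))

end Flow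

section Lyapunov

/- Comparing with a constant barrier between `f 0` and `ℓ` shows that `f` stays below `ℓ`, so the
differential inequality holds on all of `[0, T]` and Grönwall applies. -/
lemma lt_and_le_mul_exp_of_deriv_right_le {f f' : ℝ → ℝ} {T ρ ℓ : ℝ} (hρ : 0 < ρ) (hℓ : 0 < ℓ)
    (hf : ContinuousOn f (Icc 0 T)) (hf' : ∀ t ∈ Ico 0 T, HasDerivWithinAt f (f' t) (Ici t) t)
    (h₀ : f 0 < ℓ) (hdecay : ∀ t ∈ Ico 0 T, f t < ℓ → f' t ≤ -ρ * f t) :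
    ∀ t ∈ Icc 0 T, f t < ℓ ∧ f t ≤ f 0 * Real.exp (-ρ * t) := by
  obtain ⟨b, hb, hbℓ⟩ := exists_between (max_lt h₀ hℓ)
  obtain ⟨hb₀, hbpos⟩ := max_lt_iff.1 hb
  have hlt : ∀ t ∈ Icc 0 T, f t < ℓ := fun t ht =>
    (image_le_of_deriv_right_lt_deriv_boundary hf hf' hb₀.le (fun x => hasDerivAt_const x b)
      (fun x hx hfx => by nlinarith [hdecay x hx (hfx ▸ hbℓ)]) ht).trans_lt hbℓ
  refine fun t ht => ⟨hlt t ht, ?_⟩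
  have hgronwall := le_gronwallBound_of_liminf_deriv_right_le (K := -ρ) (ε := 0) hf
    (fun x hx _ hr => (hf' x hx).liminf_right_slope_le hr) le_rfl
    (fun x hx => by simpa using hdecay x hx (hlt x (Ico_subset_Icc_self hx))) t ht
  rwa [gronwallBound_ε0, sub_zero] at hgronwall

lemma norm_sub_le_of_lyapunov_le {X : Type*} [SeminormedAddCommGroup X] {V : X → ℝ} {p : X}
    {c C ρ : ℝ} (hc : 0 < c) (hC : 0 < C)
    (hlow : ∀ s, c * ‖s - p‖ ^ 2 ≤ V s) (hup : ∀ s, V s ≤ C * ‖s - p‖ ^ 2) {s s₀ : X} {t : ℝ}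
    (h : V s ≤ V s₀ * Real.exp (-ρ * t)) :
    ‖s - p‖ ≤ √(C / c) * Real.exp (-(ρ / 2) * t) * ‖s₀ - p‖ := by
  refine le_of_sq_le_sq ?_ (by positivity)
  have hexp : Real.exp (-(ρ / 2) * t) ^ 2 = Real.exp (-ρ * t) := by
    rw [← Real.exp_nat_mul]
    ring_nf
  rw [mul_pow, mul_pow, Real.sq_sqrt (by positivity), hexp]
  refine le_of_mul_le_mul_left ?_ hc
  calc c * ‖s - p‖ ^ 2 ≤ V s₀ * Real.exp (-ρ * t) := (hlow s).trans h
    _ ≤ C * ‖s₀ - p‖ ^ 2 * Real.exp (-ρ * t) := by gcongr; exact hup s₀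
    _ = c * (C / c * Real.exp (-ρ * t) * ‖s₀ - p‖ ^ 2) := by field_simp

variable {X : Type*} [NormedAddCommGroup X] [NormedSpace ℝ X] {F : X → X} {D : Set X} {p : X}
  {r : ℝ} {V : X → ℝ} {V' : X → X →L[ℝ] ℝ} {c C ρ rate : ℝ}

lemma mem_closedBall_and_lyapunov_le (hr : 0 < r) (hV : ∀ s, HasFDerivAt V (V' s) s)
    (hc : 0 < c) (hlow : ∀ s, c * ‖s - p‖ ^ 2 ≤ V s)
    (hρ : 0 < ρ) (hdecay : ∀ s ∈ closedBall p r, V' s (F s) ≤ -ρ * V s)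
    {ζ : ℝ → X} {T : ℝ} (hζ : IsIntegralCurveOn ζ (fun _ => F) (Icc 0 T))
    (h₀ : V (ζ 0) < c * r ^ 2) {t : ℝ} (ht : t ∈ Icc 0 T) :
    ζ t ∈ closedBall p r ∧ V (ζ t) ≤ V (ζ 0) * Real.exp (-ρ * t) := by
  have hmem : ∀ s, V s < c * r ^ 2 → s ∈ closedBall p r := fun s hs => by
    rw [mem_closedBall, dist_eq_norm]
    exact le_of_sq_le_sq (le_of_mul_le_mul_left ((hlow s).trans hs.le) hc) hr.le
  have hVc : Continuous V := continuous_iff_continuousAt.2 fun s => (hV s).continuousAt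
  obtain ⟨hlt, hle⟩ := lt_and_le_mul_exp_of_deriv_right_le hρ (by positivity)
    (hVc.comp_continuousOn hζ.continuousOn)
    (fun t ht => (hV (ζ t)).comp_hasDerivWithinAt t
      (hasDerivWithinAt_Ici_of_isIntegralCurveOn_Icc hζ ht))
    h₀ (fun t _ hVt => hdecay _ (hmem _ hVt)) t ht
  exact ⟨hmem _ hlt, hle⟩

theorem isLocallyExpStable_of_lyapunov [CompleteSpace X] (hp : IsEquilibrium F D p) (hr : 0 < r)
    (hD : closedBall p r ⊆ D) {K : ℝ≥0} (hF : LipschitzOnWith K F (closedBall p r))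
    (hV : ∀ s, HasFDerivAt V (V' s) s) (hc : 0 < c) (hC : 0 < C) (hrate : 0 < rate)
    (hlow : ∀ s, c * ‖s - p‖ ^ 2 ≤ V s) (hup : ∀ s, V s ≤ C * ‖s - p‖ ^ 2)
    (hdecay : ∀ s ∈ closedBall p r, V' s (F s) ≤ -rate * ‖s - p‖ ^ 2) :
    IsLocallyExpStable F D p := by
  have hρ : 0 < rate / C := div_pos hrate hC
  have hdecay' : ∀ s ∈ closedBall p r, V' s (F s) ≤ -(rate / C) * V s := fun s hs => by
    refine (hdecay s hs).trans ?_
    rw [neg_mul, neg_mul, neg_le_neg_iff, div_mul_eq_mul_div, div_le_iff₀ hC, mul_assoc]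
    gcongr
    linarith [hup s]
  have hstart : ∀ s, ‖s - p‖ < r * √(c / C) → V s < c * r ^ 2 := fun s hs => by
    refine (hup s).trans_lt ?_
    calc C * ‖s - p‖ ^ 2 < C * (r * √(c / C)) ^ 2 := by gcongr
      _ = c * r ^ 2 := by rw [mul_pow, Real.sq_sqrt (by positivity)]; field_simp
  refine ⟨hp, r * √(c / C), by positivity, √(C / c), by positivity, rate / C / 2, by positivity,
    fun ζ₀ hζ₀ => ⟨?_, ?_⟩⟩
  · obtain ⟨G, L, K', hGF, hGL, hGK⟩ := exists_bounded_lipschitzWith_eqOn_closedBall hr hF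
    obtain ⟨ζ, rfl, hζ⟩ := exists_isIntegralCurveOn_Ici_of_forall_Icc hGK
      fun N => exists_isIntegralCurveOn_Icc hGL hGK ζ₀ N.cast_nonneg
    have hmem : ∀ t ∈ Ici (0 : ℝ), ζ t ∈ closedBall p r := fun t ht =>
      (mem_closedBall_and_lyapunov_le hr hV hc hlow hρ
        (fun s hs => by rw [hGF hs]; exact hdecay' s hs) (hζ.mono Icc_subset_Ici_self)
        (hstart _ hζ₀) (right_mem_Icc.2 ht)).1
    exact ⟨ζ, rfl, fun t ht => hD (hmem t ht), fun t ht =>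
      (hζ t ht).congr_deriv (hGF (hmem t ht))⟩
  · rintro T ζ rfl ⟨-, hζ⟩ t ht
    have hsub : Icc 0 t ⊆ Ico 0 T := fun x hx => ⟨hx.1, hx.2.trans_lt ht.2⟩
    exact norm_sub_le_of_lyapunov_le hc hC hlow hup
      (mem_closedBall_and_lyapunov_le hr hV hc hlow hρ hdecay' (hζ.mono hsub) (hstart _ hζ₀)
        (right_mem_Icc.2 ht.1)).2

theorem isLocallyExpStable_of_bilinear_lyapunov [CompleteSpace X] (hp : IsEquilibrium F D p)
    (hr : 0 < r) (hD : closedBall p r ⊆ D) {K : ℝ≥0} (hF : LipschitzOnWith K F (closedBall p r))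
    (Φ : X →L[ℝ] X →L[ℝ] ℝ) (hc : 0 < c) (hrate : 0 < rate)
    (hlow : ∀ e, c * ‖e‖ ^ 2 ≤ Φ e e)
    (hdecay : ∀ s ∈ closedBall p r,
      Φ (s - p) (F s) + Φ (F s) (s - p) ≤ -rate * ‖s - p‖ ^ 2) :
    IsLocallyExpStable F D p := by
  have hV : ∀ s, HasFDerivAt (fun s => Φ (s - p) (s - p)) (Φ (s - p) + Φ.flip (s - p)) s := by
    intro s
    have hid : HasFDerivAt (fun s => s - p) (ContinuousLinearMap.id ℝ X) s :=
      (hasFDerivAt_id s).sub_const p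
    exact (Φ.hasFDerivAt_of_bilinear hid hid).congr_fderiv (by ext; simp)
  refine isLocallyExpStable_of_lyapunov hp hr hD hF hV hc (C := ‖Φ‖ + 1) (by positivity) hrate
    (fun s => hlow _) (fun s => ?_) hdecay
  calc Φ (s - p) (s - p) ≤ ‖Φ‖ * ‖s - p‖ * ‖s - p‖ :=
        (le_abs_self _).trans (Φ.le_opNorm₂ _ _)
    _ ≤ (‖Φ‖ + 1) * ‖s - p‖ ^ 2 := by nlinarith [sq_nonneg ‖s - p‖]

end Lyapunov

section Spectrum

variable {𝓐 : Type*} [NormedRing 𝓐] [NormedAlgebra ℂ 𝓐] [CompleteSpace 𝓐]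

lemma tendsto_pow_atTop_nhds_zero_of_spectralRadius_lt_one {a : 𝓐}
    (ha : spectralRadius ℂ a < 1) : Tendsto (fun N => a ^ N) atTop (𝓝 0) := by
  obtain ⟨q, haq, hq⟩ := ENNReal.lt_iff_exists_nnreal_btwn.1 ha
  have hroot := (spectrum.pow_nnnorm_pow_one_div_tendsto_nhds_spectralRadius a).eventually
    (Iio_mem_nhds haq)
  have hpow : ∀ᶠ N : ℕ in atTop, ‖a ^ N‖ ≤ (q : ℝ) ^ N := by
    filter_upwards [hroot, eventually_gt_atTop 0] with N hN hN₀
    have hle : (‖a ^ N‖₊ : ℝ≥0∞) ≤ (q : ℝ≥0∞) ^ (N : ℝ) := by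
      rw [← ENNReal.rpow_inv_le_iff (by positivity), ← one_div]
      exact le_of_lt hN
    rw [ENNReal.rpow_natCast] at hle
    exact_mod_cast hle
  exact squeeze_zero_norm' hpow
    (tendsto_pow_atTop_nhds_zero_of_lt_one q.2 (by exact_mod_cast hq))

lemma exists_pos_forall_spectrum_one_add_smul_norm_lt_one {a : 𝓐}
    (ha : ∀ s ∈ spectrum ℂ a, s.re < 0) :
    ∃ h : ℝ, 0 < h ∧ ∀ z ∈ spectrum ℂ (1 + (h : ℂ) • a), ‖z‖ < 1 := by
  obtain ⟨h, h₀, hle⟩ := (spectrum.isCompact a).exists_forall_le' (a := 0)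
    (f := fun s : ℂ => -2 * s.re / (‖s‖ ^ 2 + 1))
    ((continuous_const.mul Complex.continuous_re).div (by fun_prop)
      fun s => by positivity).continuousOn
    (fun s hs => div_pos (by linarith [ha s hs]) (by positivity))
  refine ⟨h, h₀, fun z hz => ?_⟩
  lift (h : ℂ) to ℂˣ using (isUnit_iff_ne_zero.2 (Complex.ofReal_ne_zero.2 h₀.ne')) with u hu
  rw [← map_one (algebraMap ℂ 𝓐), ← spectrum.singleton_add_eq, ← Units.smul_def,
    spectrum.unit_smul_eq_smul, singleton_add] at hz
  obtain ⟨-, ⟨s, hs, rfl⟩, rfl⟩ := hz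
  have hs' := hle s hs
  rw [le_div_iff₀ (by positivity)] at hs'
  have hexpand : ‖1 + (h : ℂ) * s‖ ^ 2 = 1 + h * (2 * s.re + h * ‖s‖ ^ 2) := by
    rw [Complex.sq_norm, Complex.sq_norm, Complex.normSq_apply, Complex.normSq_apply]
    simp only [Complex.add_re, Complex.one_re, Complex.mul_re, Complex.ofReal_re,
      Complex.ofReal_im, Complex.add_im, Complex.one_im, Complex.mul_im]
    ring
  have hsq : ‖1 + (h : ℂ) * s‖ ^ 2 < 1 ^ 2 := by
    rw [hexpand]
    nlinarith
  simpa [Units.smul_def, hu] using lt_of_pow_lt_pow_left₀ 2 zero_le_one hsq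

lemma exists_pos_tendsto_one_add_smul_pow_zero {a : 𝓐} (ha : ∀ s ∈ spectrum ℂ a, s.re < 0) :
    ∃ h : ℝ, 0 < h ∧ Tendsto (fun N => (1 + (h : ℂ) • a) ^ N) atTop (𝓝 0) := by
  obtain ⟨h, h₀, hspec⟩ := exists_pos_forall_spectrum_one_add_smul_norm_lt_one ha
  refine ⟨h, h₀, ?_⟩
  rcases subsingleton_or_nontrivial 𝓐 with _ | _
  · exact tendsto_const_nhds.congr fun N => Subsingleton.elim _ _
  · refine tendsto_pow_atTop_nhds_zero_of_spectralRadius_lt_one ?_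
    exact_mod_cast spectrum.spectralRadius_lt_of_forall_lt (r := 1) _
      fun z hz => by exact_mod_cast hspec z hz

end Spectrum

section LyapunovOperator

variable {E : Type*} [NormedAddCommGroup E] [InnerProductSpace ℝ E]

/-- `Θ` is a Lyapunov operator for `A` with rate `k`: the quadratic form `⟪Θ y, y⟫` dominates the
squared norm, and half its derivative along `y' = A y` is at most `-k ‖y‖²`. -/
structure IsLyapunovOperator (A Θ : E →L[ℝ] E) (k : ℝ) : Prop where
  isSymmetric : ∀ x y, ⟪Θ x, y⟫ = ⟪x, Θ y⟫
  sq_norm_le : ∀ y, ‖y‖ ^ 2 ≤ ⟪Θ y, y⟫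
  inner_le : ∀ y, ⟪Θ y, A y⟫ ≤ -k * ‖y‖ ^ 2

variable [CompleteSpace E]

/-- The Gramian `∑_{i < N} (Sⁱ)† Sⁱ`. It solves the discrete Lyapunov equation
`S† Θ S = Θ + (Sᴺ)† Sᴺ - 1`. -/
noncomputable def gramian (S : E →L[ℝ] E) (N : ℕ) : E →L[ℝ] E :=
  ∑ i ∈ Finset.range N, (S ^ i).adjoint ∘L (S ^ i)

lemma inner_gramian (S : E →L[ℝ] E) (N : ℕ) (x y : E) :
    ⟪gramian S N x, y⟫ = ∑ i ∈ Finset.range N, ⟪(S ^ i) x, (S ^ i) y⟫ := by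
  simp only [gramian, sum_apply, sum_inner, ContinuousLinearMap.comp_apply,
    ContinuousLinearMap.adjoint_inner_left]

lemma inner_gramian_symm (S : E →L[ℝ] E) (N : ℕ) (x y : E) :
    ⟪gramian S N x, y⟫ = ⟪x, gramian S N y⟫ := by
  rw [real_inner_comm _ x, inner_gramian, inner_gramian]
  exact Finset.sum_congr rfl fun i _ => real_inner_comm _ _

lemma inner_gramian_self (S : E →L[ℝ] E) (N : ℕ) (y : E) :
    ⟪gramian S N y, y⟫ = ∑ i ∈ Finset.range N, ‖(S ^ i) y‖ ^ 2 := by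
  rw [inner_gramian]
  exact Finset.sum_congr rfl fun i _ => real_inner_self_eq_norm_sq _

lemma inner_gramian_map_self (S : E →L[ℝ] E) (N : ℕ) (y : E) :
    ⟪gramian S N (S y), S y⟫ = ⟪gramian S N y, y⟫ + ‖(S ^ N) y‖ ^ 2 - ‖y‖ ^ 2 := by
  have hshift : ∀ i, (S ^ i) (S y) = (S ^ (i + 1)) y := fun i => by rw [pow_succ]; rfl
  simp only [inner_gramian_self, hshift]
  have htelescope := Finset.sum_range_sub (fun i => ‖(S ^ i) y‖ ^ 2) N
  rw [Finset.sum_sub_distrib, pow_zero, one_apply_eq_self] at htelescope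
  linarith

/- Stein's construction: the Gramian of the Euler step `1 + hA` is a Lyapunov operator for `A`,
since the Euler step decreases its quadratic form and the second-order term in `h` is
nonnegative. -/
lemma exists_isLyapunovOperator_of_norm_pow_le {A : E →L[ℝ] E} {h : ℝ} (h₀ : 0 < h) {N : ℕ}
    (hN₀ : 0 < N) (hN : ‖(1 + h • A) ^ N‖ ≤ 1 / 2) :
    ∃ Θ : E →L[ℝ] E, ∃ k > 0, IsLyapunovOperator A Θ k := by
  set S := 1 + h • A
  refine ⟨gramian S N, 3 / (8 * h), by positivity, inner_gramian_symm S N, fun y => ?_,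
    fun y => ?_⟩
  · rw [inner_gramian_self]
    exact Finset.single_le_sum (f := fun i => ‖(S ^ i) y‖ ^ 2) (fun i _ => sq_nonneg _)
      (Finset.mem_range.2 hN₀)
  · have hcontract : ‖(S ^ N) y‖ ^ 2 ≤ 1 / 4 * ‖y‖ ^ 2 := by
      have hle : ‖(S ^ N) y‖ ≤ 1 / 2 * ‖y‖ := (S ^ N).le_of_opNorm_le hN y
      nlinarith [norm_nonneg ((S ^ N) y)]
    have hexpand : ⟪gramian S N (S y), S y⟫ = ⟪gramian S N y, y⟫
        + 2 * h * ⟪gramian S N y, A y⟫ + h ^ 2 * ⟪gramian S N (A y), A y⟫ := by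
      simp only [S, add_apply, one_apply_eq_self, smul_apply, map_add, map_smul, inner_add_left,
        inner_add_right, real_inner_smul_left, real_inner_smul_right,
        inner_gramian_symm _ _ (A y) y, real_inner_comm _ (A y)]
      ring
    have hsecond : 0 ≤ ⟪gramian S N (A y), A y⟫ := by
      rw [inner_gramian_self]
      positivity
    have hfirst : 2 * h * ⟪gramian S N y, A y⟫ ≤ -(3 / 4) * ‖y‖ ^ 2 := by
      nlinarith [inner_gramian_map_self S N y, sq_nonneg h]
    rw [show -(3 / (8 * h)) * ‖y‖ ^ 2 = -(3 / 4) * ‖y‖ ^ 2 / (2 * h) by field_simp; ring,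
      le_div_iff₀ (by positivity)]
    linarith

end LyapunovOperator

section Hurwitz

variable {j k l : ℕ}

/-- The continuous linear map `v ↦ M v`, that is, `act` as a linear function of the matrix. -/
noncomputable def actL :
    Matrix (Fin k) (Fin l) ℝ ≃ₗ[ℝ] Vec l →L[ℝ] Vec k :=
  Matrix.toEuclideanLin ≪≫ₗ LinearMap.toContinuousLinearMap

lemma act_eq_actL (M : Matrix (Fin k) (Fin l) ℝ) (v : Vec l) : act M v = actL M v := rfl

lemma actL_mul (M : Matrix (Fin j) (Fin k) ℝ) (N : Matrix (Fin k) (Fin l) ℝ) :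
    actL (M * N) = actL M ∘L actL N := by
  ext1 v
  simp [actL, Matrix.toLpLin_apply]

lemma actL_one : actL (1 : Matrix (Fin k) (Fin k) ℝ) = 1 := by
  ext1 v
  simp [actL]

lemma actL_actL_inv {M : Matrix (Fin k) (Fin k) ℝ} (hM : IsUnit M) (v : Vec k) :
    actL M (actL M⁻¹ v) = v := by
  rw [← ContinuousLinearMap.comp_apply, ← actL_mul,
    Matrix.mul_nonsing_inv _ (M.isUnit_iff_isUnit_det.1 hM), actL_one, one_apply_eq_self]

lemma actL_inv_actL {M : Matrix (Fin k) (Fin k) ℝ} (hM : IsUnit M) (v : Vec k) :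
    actL M⁻¹ (actL M v) = v := by
  rw [← ContinuousLinearMap.comp_apply, ← actL_mul,
    Matrix.nonsing_inv_mul _ (M.isUnit_iff_isUnit_det.1 hM), actL_one, one_apply_eq_self]

lemma actL_pow (M : Matrix (Fin k) (Fin k) ℝ) (N : ℕ) : actL (M ^ N) = actL M ^ N := by
  induction N with
  | zero => rw [pow_zero, pow_zero, actL_one]
  | succ N ih => rw [pow_succ, pow_succ, actL_mul, ih]; rfl

lemma actL_transpose (M : Matrix (Fin k) (Fin l) ℝ) : actL M.transpose = (actL M).adjoint := by
  rw [← M.conjTranspose_eq_transpose_of_trivial]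
  exact congrArg LinearMap.toContinuousLinearMap
    (Matrix.toEuclideanLin_conjTranspose_eq_adjoint M)

open scoped Matrix.Norms.Operator in
lemma IsHurwitz.exists_tendsto_one_add_smul_pow_zero {A : Matrix (Fin k) (Fin k) ℝ}
    (hA : IsHurwitz A) :
    ∃ h : ℝ, 0 < h ∧ Tendsto (fun N => (1 + h • A) ^ N) atTop (𝓝 0) := by
  obtain ⟨h, h₀, hlim⟩ := exists_pos_tendsto_one_add_smul_pow_zero hA
  have hmap : (1 + (h : ℂ) • A.map Complex.ofReal) = Complex.ofRealHom.mapMatrix (1 + h • A) := by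
    rw [map_add, map_one]
    congr 1
    ext i j
    simp
  have hre := ((continuous_id.matrix_map Complex.continuous_re).tendsto 0).comp hlim
  refine ⟨h, h₀, ?_⟩
  convert! hre using 2 with N
  · rw [Function.comp_apply, hmap, ← map_pow]
    ext i j
    simp

theorem IsHurwitz.exists_isLyapunovOperator {A : Matrix (Fin k) (Fin k) ℝ} (hA : IsHurwitz A) :
    ∃ Θ : Vec k →L[ℝ] Vec k, ∃ κ > 0, IsLyapunovOperator (actL A) Θ κ := by
  obtain ⟨h, h₀, hlim⟩ := hA.exists_tendsto_one_add_smul_pow_zero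
  have hnorm : Tendsto (fun N => ‖(1 + h • actL A) ^ N‖) atTop (𝓝 0) := by
    have hcont := (LinearMap.continuous_of_finiteDimensional
      (actL (k := k) (l := k)).toLinearMap).norm
    simpa [Function.comp_def, actL_pow, actL_one] using (hcont.tendsto 0).comp hlim
  obtain ⟨N, hN, hN₀⟩ := ((hnorm.eventually (Iic_mem_nhds (show (0 : ℝ) < 1 / 2 by norm_num))).and
    (eventually_gt_atTop 0)).exists
  exact exists_isLyapunovOperator_of_norm_pow_le h₀ hN₀ hN

lemma IsHurwitz.isUnit {A : Matrix (Fin k) (Fin k) ℝ} (hA : IsHurwitz A) : IsUnit A := by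
  rw [Matrix.isUnit_iff_isUnit_det, isUnit_iff_ne_zero]
  intro hdet
  have hzero : (0 : ℂ) ∈ spectrum ℂ (A.map Complex.ofReal) := by
    rw [spectrum.zero_mem_iff, Matrix.isUnit_iff_isUnit_det, isUnit_iff_ne_zero, not_not]
    exact (Complex.ofRealHom.map_det A).symm.trans (by rw [hdet, map_zero])
  simpa using hA 0 hzero

end Hurwitz

section LoopLyapunov

lemma mul_mul_le_young {a p q : ℝ} (b : ℝ) (ha : 0 < a) :
    b * (p * q) ≤ a / 4 * p ^ 2 + b ^ 2 / a * q ^ 2 := by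
  have square : a / 4 * p ^ 2 + b ^ 2 / a * q ^ 2 - b * (p * q)
      = (a * p - 2 * b * q) ^ 2 / (4 * a) := by
    field_simp
    ring
  have : 0 ≤ (a * p - 2 * b * q) ^ 2 / (4 * a) := by positivity
  linarith

/-- The smallness of `c`, the weight of the cross term in the Lyapunov function of the primal-dual
loop, and the largeness of `τ`, the bound on the time constants, under which that function
decreases. Here `K` bounds all gains of the loop, `k` is the decay rate of the plant, `κ` the
modulus of convexity and `σ` a lower bound for `M M*`, `M` the constraint operator. -/
structure TuningConstants (K k κ σ c τ : ℝ) : Prop where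
  one_le_K : 1 ≤ K
  k_pos : 0 < k
  κ_pos : 0 < κ
  σ_pos : 0 < σ
  c_pos : 0 < c
  τ_pos : 0 < τ
  c_le_one : 4 * c * K ^ 4 ≤ 1
  c_le_κ : 4 * c * K ^ 4 ≤ κ
  c_le_κσ : 4 * c * K ^ 4 ≤ κ * σ
  le_kτ : 2 * K ^ 2 + 16 * K ^ 4 / κ ≤ k * τ
  le_cτ : 32 * K ^ 4 / (σ * k) ≤ c * τ

lemma exists_tuningConstants {K k κ σ : ℝ} (hK : 1 ≤ K) (hk : 0 < k) (hκ : 0 < κ) (hσ : 0 < σ) :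
    ∃ c τ, TuningConstants K k κ σ c τ := by
  have : 0 < K := one_pos.trans_le hK
  let m := min 1 (min κ (κ * σ))
  have hm : 0 < m := lt_min one_pos (lt_min hκ (mul_pos hκ hσ))
  have hc : 4 * (m / (4 * K ^ 4)) * K ^ 4 = m := by field_simp
  have hc₀ : 0 < m / (4 * K ^ 4) := by positivity
  refine ⟨m / (4 * K ^ 4), max ((2 * K ^ 2 + 16 * K ^ 4 / κ) / k)
    (32 * K ^ 4 / (σ * k) / (m / (4 * K ^ 4))), hK, hk, hκ, hσ, hc₀,
    lt_max_of_lt_left (by positivity), hc.trans_le (min_le_left _ _),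
    hc.trans_le ((min_le_right _ _).trans (min_le_left _ _)),
    hc.trans_le ((min_le_right _ _).trans (min_le_right _ _)), ?_, ?_⟩
  · rw [← div_le_iff₀' hk]
    exact le_max_left _ _
  · rw [← div_le_iff₀' hc₀]
    exact le_max_right _ _

namespace TuningConstants

variable {K k κ σ c τ : ℝ}

lemma K_pos (h : TuningConstants K k κ σ c τ) : 0 < K := one_pos.trans_le h.one_le_K

lemma four_mul_c_mul_pow_le (h : TuningConstants K k κ σ c τ) {j : ℕ} (hj : j ≤ 4) :
    4 * c * K ^ j ≤ 4 * c * K ^ 4 := by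
  have := h.c_pos
  gcongr
  exact h.one_le_K

lemma weight_le_one (h : TuningConstants K k κ σ c τ) : c ≤ 1 := by
  have h₁ := h.four_mul_c_mul_pow_le (Nat.zero_le 4)
  linarith [h.c_le_one, h.c_pos]

lemma scalar_decrease (h : TuningConstants K k κ σ c τ) {τp ρ β Y U N : ℝ}
    (hτ : τ ≤ τp) (hρ₀ : 0 < ρ) (hρ : ρ ≤ c) (hβ : β ≤ c)
    (hρτ : c * τ ≤ ρ * τp) (hY : 0 ≤ Y) (hU : 0 ≤ U) (hN : 0 ≤ N) :
    -(2 * τp * k) * Y ^ 2 + 2 * K ^ 2 * Y * (U + N + Y) + (-κ * U ^ 2 + K * U * Y + K * Y * N)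
      + ρ * (K ^ 2 * (U + Y) * N - σ * N ^ 2) + β * (K ^ 2 * U ^ 2 + K ^ 2 * U * Y)
      ≤ -(k * τp / 2 * Y ^ 2 + κ / 4 * U ^ 2 + ρ * σ / 2 * N ^ 2) := by
  have ⟨hK, hk, hκ, hσ, _, _, _, hcκ, hcκσ, hkτ, hcτ⟩ := h
  have hc := h.weight_le_one
  have hK₂ : K ≤ K ^ 2 := le_self_pow₀ hK two_ne_zero
  have absorb : ∀ {a b p q : ℝ}, 0 < a → b ≤ 4 * K ^ 2 → 0 ≤ p → 0 ≤ q →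
      b * (p * q) ≤ a / 4 * p ^ 2 + 16 * K ^ 4 / a * q ^ 2 := fun {a b p q} ha hb hp hq => by
    have h₁ : b * (p * q) ≤ 4 * K ^ 2 * (p * q) := by gcongr
    refine h₁.trans ((mul_mul_le_young _ ha).trans_eq ?_)
    ring
  have hUY : (2 * K ^ 2 + K + β * K ^ 2) * (U * Y) ≤ κ / 4 * U ^ 2 + 16 * K ^ 4 / κ * Y ^ 2 :=
    absorb hκ (by nlinarith) hU hY
  have hNY : (2 * K ^ 2 + K + ρ * K ^ 2) * (N * Y)
      ≤ ρ * σ / 4 * N ^ 2 + 16 * K ^ 4 / (ρ * σ) * Y ^ 2 :=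
    absorb (by positivity) (by nlinarith) hN hY
  have hNU : ρ * K ^ 2 * (N * U) ≤ ρ * σ / 4 * N ^ 2 + κ / 4 * U ^ 2 := by
    have h₁ : (ρ * K ^ 2) ^ 2 / (ρ * σ) ≤ κ / 4 := by
      rw [div_le_iff₀ (by positivity)]
      have h₂ : ρ * (4 * ρ * K ^ 4) ≤ ρ * (4 * c * K ^ 4) := by gcongr
      linarith [mul_le_mul_of_nonneg_left hcκσ hρ₀.le]
    exact (mul_mul_le_young (a := ρ * σ) _ (by positivity)).trans (by gcongr)
  have hUU : β * K ^ 2 * U ^ 2 ≤ κ / 4 * U ^ 2 := by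
    gcongr
    have h₁ : β * K ^ 2 ≤ c * K ^ 2 := by gcongr
    linarith [h.four_mul_c_mul_pow_le (j := 2) (by norm_num), hcκ]
  have hYY : (2 * K ^ 2 + 16 * K ^ 4 / κ + 16 * K ^ 4 / (ρ * σ)) * Y ^ 2
      ≤ (k * τp + k * τp / 2) * Y ^ 2 := by
    have h₁ : k * τ ≤ k * τp := by gcongr
    have h₂ := hcτ.trans hρτ
    rw [div_le_iff₀ (by positivity)] at h₂
    have h₃ : 16 * K ^ 4 / (ρ * σ) ≤ k * τp / 2 := by
      rw [div_le_iff₀ (by positivity)]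
      linarith
    gcongr
    exact hkτ.trans h₁
  linarith

end TuningConstants

lemma norm_sq_le_deviation {E F H : Type*} [NormedAddCommGroup E] [NormedSpace ℝ E]
    [NormedAddCommGroup F] [NormedSpace ℝ F] [NormedAddCommGroup H] (Q : F →L[ℝ] E)
    (e : E × F × H) :
    ‖e‖ ^ 2 ≤ (2 + 2 * ‖Q‖ ^ 2) * (‖e.1 + Q e.2.1‖ ^ 2 + ‖e.2.1‖ ^ 2 + ‖e.2.2‖ ^ 2) := by
  have hx : ‖e.1‖ ≤ ‖e.1 + Q e.2.1‖ + ‖Q‖ * ‖e.2.1‖ := calc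
    ‖e.1‖ = ‖(e.1 + Q e.2.1) - Q e.2.1‖ := by rw [add_sub_cancel_right]
    _ ≤ ‖e.1 + Q e.2.1‖ + ‖Q e.2.1‖ := norm_sub_le _ _
    _ ≤ _ := by gcongr; exact Q.le_opNorm _
  have hmax : ‖e‖ = max ‖e.1‖ (max ‖e.2.1‖ ‖e.2.2‖) := rfl
  set Y := ‖e.1 + Q e.2.1‖
  set U := ‖e.2.1‖
  set N := ‖e.2.2‖
  have hQY : 0 ≤ ‖Q‖ ^ 2 * Y ^ 2 := by positivity
  have hQU : 0 ≤ ‖Q‖ ^ 2 * U ^ 2 := by positivity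
  have hQN : 0 ≤ ‖Q‖ ^ 2 * N ^ 2 := by positivity
  have hx₂ : ‖e.1‖ ^ 2 ≤ (Y + ‖Q‖ * U) ^ 2 := by gcongr
  rw [hmax]
  rcases max_choice ‖e.1‖ (max U N) with h | h <;> rw [h]
  · nlinarith [sq_nonneg (Y - ‖Q‖ * U), sq_nonneg U, sq_nonneg N]
  · rcases max_choice U N with h | h <;> rw [h] <;>
      nlinarith [sq_nonneg Y, sq_nonneg U, sq_nonneg N]

variable {E F H : Type*} [NormedAddCommGroup E] [InnerProductSpace ℝ E]
  [NormedAddCommGroup F] [InnerProductSpace ℝ F] [NormedAddCommGroup H] [InnerProductSpace ℝ H]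

/-- The bilinear form
`((x, u, μ), (x', u', μ')) ↦ τp⟪Θ y, y'⟫ + τp/2 ⟪u, u'⟫ + τd/2 ⟪μ, μ'⟫ + ε⟪M u, μ'⟫`, where
`y = x + Q u` is the deviation of the plant from its steady state for the input `u`. On the
diagonal it is the Lyapunov function of the primal-dual loop, in deviations from equilibrium. -/
noncomputable def lyapunovForm (Θ : E →L[ℝ] E) (Q : F →L[ℝ] E) (M : F →L[ℝ] H) (τp τd ε : ℝ) :
    E × F × H →L[ℝ] E × F × H →L[ℝ] ℝ :=
  let u : E × F × H →L[ℝ] F := .comp (.fst ℝ F H) (.snd ℝ E (F × H))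
  let μ : E × F × H →L[ℝ] H := .comp (.snd ℝ F H) (.snd ℝ E (F × H))
  let y : E × F × H →L[ℝ] E := .fst ℝ E (F × H) + Q.comp u
  τp • (innerSL ℝ (E := E) : E →L[ℝ] E →L[ℝ] ℝ).bilinearComp (Θ.comp y) y
    + (τp / 2) • (innerSL ℝ (E := F) : F →L[ℝ] F →L[ℝ] ℝ).bilinearComp u u
    + (τd / 2) • (innerSL ℝ (E := H) : H →L[ℝ] H →L[ℝ] ℝ).bilinearComp μ μ
    + ε • (innerSL ℝ (E := H) : H →L[ℝ] H →L[ℝ] ℝ).bilinearComp (M.comp u) μ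

lemma lyapunovForm_apply (Θ : E →L[ℝ] E) (Q : F →L[ℝ] E) (M : F →L[ℝ] H) (τp τd ε : ℝ)
    (e v : E × F × H) :
    lyapunovForm Θ Q M τp τd ε e v = τp * ⟪Θ (e.1 + Q e.2.1), v.1 + Q v.2.1⟫
      + τp / 2 * ⟪e.2.1, v.2.1⟫ + τd / 2 * ⟪e.2.2, v.2.2⟫ + ε * ⟪M e.2.1, v.2.2⟫ :=
  rfl

lemma lyapunovForm_add_flip {Θ : E →L[ℝ] E} (hΘ : ∀ x y, ⟪Θ x, y⟫ = ⟪x, Θ y⟫)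
    (Q : F →L[ℝ] E) (M : F →L[ℝ] H) (τp τd ε : ℝ) (e v : E × F × H) :
    lyapunovForm Θ Q M τp τd ε e v + lyapunovForm Θ Q M τp τd ε v e
      = 2 * τp * ⟪Θ (e.1 + Q e.2.1), v.1 + Q v.2.1⟫ + (τp * ⟪e.2.1, v.2.1⟫ + τd * ⟪e.2.2, v.2.2⟫)
        + ε * (⟪M v.2.1, e.2.2⟫ + ⟪M e.2.1, v.2.2⟫) := by
  rw [lyapunovForm_apply, lyapunovForm_apply, hΘ (v.1 + Q v.2.1),
    real_inner_comm (Θ (e.1 + Q e.2.1)), real_inner_comm e.2.1, real_inner_comm e.2.2 v.2.2]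
  ring

lemma mul_norm_sq_le_lyapunovForm {A Θ : E →L[ℝ] E} {k : ℝ} (hΘ : IsLyapunovOperator A Θ k)
    (Q : F →L[ℝ] E) {M : F →L[ℝ] H} {K c τp τd : ℝ} (hM : ‖M‖ ≤ K) (hc₀ : 0 ≤ c)
    (hc : 4 * c * K ≤ 1) (hτp : 0 < τp) (hτd : 0 < τd) (e : E × F × H) :
    min τp τd / 4 / (2 + 2 * ‖Q‖ ^ 2) * ‖e‖ ^ 2
      ≤ lyapunovForm Θ Q M τp τd (c * min τp τd) e e := by
  have hm₀ : 0 < min τp τd := lt_min hτp hτd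
  suffices h : min τp τd / 4 * (‖e.1 + Q e.2.1‖ ^ 2 + ‖e.2.1‖ ^ 2 + ‖e.2.2‖ ^ 2)
      ≤ lyapunovForm Θ Q M τp τd (c * min τp τd) e e by
    rw [div_mul_eq_mul_div, div_le_iff₀ (by positivity)]
    linarith [mul_le_mul_of_nonneg_left (norm_sq_le_deviation Q e)
      (show 0 ≤ min τp τd / 4 by positivity),
      mul_le_mul_of_nonneg_left h (show 0 ≤ 2 + 2 * ‖Q‖ ^ 2 by positivity)]
  rw [lyapunovForm_apply, real_inner_self_eq_norm_sq, real_inner_self_eq_norm_sq]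
  have hY := hΘ.sq_norm_le (e.1 + Q e.2.1)
  have hcross : -⟪M e.2.1, e.2.2⟫ ≤ K * ‖e.2.1‖ * ‖e.2.2‖ :=
    (neg_le_abs _).trans ((abs_real_inner_le_norm _ _).trans
      (by gcongr; exact M.le_of_opNorm_le hM _))
  set Y := ‖e.1 + Q e.2.1‖
  set U := ‖e.2.1‖
  set N := ‖e.2.2‖
  set m := min τp τd
  have hmp : m ≤ τp := min_le_left _ _
  have hmd : m ≤ τd := min_le_right _ _
  have hcK : 4 * c * K * (m * (U * N)) ≤ 1 * (m * (U * N)) := by gcongr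
  have hUN : m * (2 * (U * N)) ≤ m * (U ^ 2 + N ^ 2) := by
    gcongr
    linarith [two_mul_le_add_sq U N]
  have hmY : m * Y ^ 2 ≤ τp * ⟪Θ (e.1 + Q e.2.1), e.1 + Q e.2.1⟫ := by gcongr
  have hmU : m * U ^ 2 ≤ τp * U ^ 2 := by gcongr
  have hmN : m * N ^ 2 ≤ τd * N ^ 2 := by gcongr
  have hmc := mul_le_mul_of_nonneg_left hcross (show 0 ≤ c * m by positivity)
  have : 0 ≤ m * Y ^ 2 := by positivity
  have : 0 ≤ m * U ^ 2 := by positivity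
  have : 0 ≤ m * N ^ 2 := by positivity
  linarith

variable [CompleteSpace F] [CompleteSpace H]

/-- Common bounds on the gains of the primal-dual loop: `K` bounds the operators, `k` is the decay
rate of the plant in the norm of `Θ`, and `σ` bounds `M M*` below. -/
structure LoopBounds (A Θ : E →L[ℝ] E) (Q : F →L[ℝ] E) (M : F →L[ℝ] H) (S : E →L[ℝ] H)
    (K k σ : ℝ) : Prop where
  isLyapunovOperator : IsLyapunovOperator A Θ k
  norm_mul_norm_le : ‖Θ‖ * ‖Q‖ ≤ K
  norm_M_le : ‖M‖ ≤ K
  norm_S_le : ‖S‖ ≤ K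
  le_norm_adjoint_sq : ∀ μ, σ * ‖μ‖ ^ 2 ≤ ‖M.adjoint μ‖ ^ 2

/-- `v` is the velocity of the primal-dual loop at the deviation `e = (x, u, μ)` from its
equilibrium. The deviation of the gradient of the reduced cost is split into the part `g`
caused by the input deviation `u`, which is strongly monotone, and the part `d` caused by the
deviation `x + Q u` of the plant from its steady state. -/
structure IsDeviationDynamics (A : E →L[ℝ] E) (Q : F →L[ℝ] E) (M : F →L[ℝ] H) (S : E →L[ℝ] H)
    (κ L τp τd : ℝ) (e v : E × F × H) (g d : F) : Prop where
  state : v.1 = A (e.1 + Q e.2.1)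
  primal : τp • v.2.1 = -g - M.adjoint e.2.2 - d
  dual : τd • v.2.2 = M e.2.1 + S (e.1 + Q e.2.1)
  strongly_monotone : κ * ‖e.2.1‖ ^ 2 ≤ ⟪g, e.2.1⟫
  norm_g_le : ‖g‖ ≤ L * ‖e.2.1‖
  norm_d_le : ‖d‖ ≤ L * ‖e.1 + Q e.2.1‖

namespace IsDeviationDynamics

variable {A Θ : E →L[ℝ] E} {Q : F →L[ℝ] E} {M : F →L[ℝ] H} {S : E →L[ℝ] H}
  {K k κ σ c τ τp τd : ℝ} {e v : E × F × H} {g d : F}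

lemma mono {L : ℝ} (h : IsDeviationDynamics A Q M S κ L τp τd e v g d) (hL : L ≤ K) :
    IsDeviationDynamics A Q M S κ K τp τd e v g d where
  __ := h
  norm_g_le := h.norm_g_le.trans (by gcongr)
  norm_d_le := h.norm_d_le.trans (by gcongr)

lemma norm_smul_le (h : IsDeviationDynamics A Q M S κ K τp τd e v g d) (hM : ‖M‖ ≤ K) :
    ‖τp • v.2.1‖ ≤ K * (‖e.2.1‖ + ‖e.2.2‖ + ‖e.1 + Q e.2.1‖) := calc
  ‖τp • v.2.1‖ = ‖-g - M.adjoint e.2.2 - d‖ := by rw [h.primal]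
  _ ≤ ‖g‖ + ‖M.adjoint e.2.2‖ + ‖d‖ := by
    rw [← norm_neg g]
    exact (norm_sub_le _ _).trans (by gcongr; exact norm_sub_le _ _)
  _ ≤ K * ‖e.2.1‖ + K * ‖e.2.2‖ + K * ‖e.1 + Q e.2.1‖ := by
    gcongr
    · exact h.norm_g_le
    · exact M.adjoint.le_of_opNorm_le ((LinearIsometryEquiv.norm_map _ _).trans_le hM) _
    · exact h.norm_d_le
  _ = _ := by ring

lemma two_mul_inner_state_le (h : IsDeviationDynamics A Q M S κ K τp τd e v g d)
    (hB : LoopBounds A Θ Q M S K k σ) (hK : 0 ≤ K) (hτp : 0 < τp) :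
    2 * τp * ⟪Θ (e.1 + Q e.2.1), v.1 + Q v.2.1⟫ ≤ -(2 * τp * k) * ‖e.1 + Q e.2.1‖ ^ 2
      + 2 * K ^ 2 * ‖e.1 + Q e.2.1‖ * (‖e.2.1‖ + ‖e.2.2‖ + ‖e.1 + Q e.2.1‖) := by
  have hdecay := mul_le_mul_of_nonneg_left (hB.isLyapunovOperator.inner_le (e.1 + Q e.2.1))
    (show 0 ≤ 2 * τp by positivity)
  have hv := h.norm_smul_le hB.norm_M_le
  rw [h.state, inner_add_right]
  set y := e.1 + Q e.2.1
  have hQv : τp * ⟪Θ y, Q v.2.1⟫ ≤ K * ‖y‖ * (K * (‖e.2.1‖ + ‖e.2.2‖ + ‖y‖)) := calc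
    τp * ⟪Θ y, Q v.2.1⟫ = ⟪Θ y, Q (τp • v.2.1)⟫ := by rw [map_smul, real_inner_smul_right]
    _ ≤ ‖Θ y‖ * ‖Q (τp • v.2.1)‖ := real_inner_le_norm _ _
    _ ≤ (‖Θ‖ * ‖y‖) * (‖Q‖ * ‖τp • v.2.1‖) := by
      gcongr
      · exact Θ.le_opNorm _
      · exact Q.le_opNorm _
    _ = (‖Θ‖ * ‖Q‖) * ‖y‖ * ‖τp • v.2.1‖ := by ring
    _ ≤ _ := by gcongr; exact hB.norm_mul_norm_le
  linarith

/-- The skew coupling of `u` and `μ` through `M` cancels. -/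
lemma energy_le (h : IsDeviationDynamics A Q M S κ K τp τd e v g d) (hS : ‖S‖ ≤ K) :
    τp * ⟪e.2.1, v.2.1⟫ + τd * ⟪e.2.2, v.2.2⟫ ≤ -κ * ‖e.2.1‖ ^ 2
      + K * ‖e.2.1‖ * ‖e.1 + Q e.2.1‖ + K * ‖e.1 + Q e.2.1‖ * ‖e.2.2‖ := by
  rw [← real_inner_smul_right, ← real_inner_smul_right, h.primal, h.dual, inner_sub_right,
    inner_sub_right, inner_neg_right, inner_add_right, ContinuousLinearMap.adjoint_inner_right,
    real_inner_comm (M e.2.1), real_inner_comm g]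
  have hd : -⟪e.2.1, d⟫ ≤ ‖e.2.1‖ * (K * ‖e.1 + Q e.2.1‖) :=
    (neg_le_abs _).trans ((abs_real_inner_le_norm _ _).trans (by gcongr; exact h.norm_d_le))
  have hS : ⟪e.2.2, S (e.1 + Q e.2.1)⟫ ≤ ‖e.2.2‖ * (K * ‖e.1 + Q e.2.1‖) :=
    (real_inner_le_norm _ _).trans (by gcongr; exact S.le_of_opNorm_le hS _)
  linarith [h.strongly_monotone]

lemma cross_primal_le (h : IsDeviationDynamics A Q M S κ K τp τd e v g d)
    (hB : LoopBounds A Θ Q M S K k σ) (hK : 0 ≤ K) :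
    τp * ⟪M v.2.1, e.2.2⟫
      ≤ K ^ 2 * (‖e.2.1‖ + ‖e.1 + Q e.2.1‖) * ‖e.2.2‖ - σ * ‖e.2.2‖ ^ 2 := by
  rw [← real_inner_smul_left, ← map_smul, ← ContinuousLinearMap.adjoint_inner_right, h.primal,
    inner_sub_left, inner_sub_left, inner_neg_left, real_inner_self_eq_norm_sq]
  have hμ : ‖M.adjoint e.2.2‖ ≤ K * ‖e.2.2‖ :=
    M.adjoint.le_of_opNorm_le ((LinearIsometryEquiv.norm_map _ _).trans_le hB.norm_M_le) _
  have hg : -⟪g, M.adjoint e.2.2⟫ ≤ (K * ‖e.2.1‖) * (K * ‖e.2.2‖) :=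
    (neg_le_abs _).trans ((abs_real_inner_le_norm _ _).trans (by gcongr; exact h.norm_g_le))
  have hd : -⟪d, M.adjoint e.2.2⟫ ≤ (K * ‖e.1 + Q e.2.1‖) * (K * ‖e.2.2‖) :=
    (neg_le_abs _).trans ((abs_real_inner_le_norm _ _).trans (by gcongr; exact h.norm_d_le))
  linarith [hB.le_norm_adjoint_sq e.2.2]

lemma cross_dual_le (h : IsDeviationDynamics A Q M S κ K τp τd e v g d)
    (hM : ‖M‖ ≤ K) (hS : ‖S‖ ≤ K) (hK : 0 ≤ K) :
    τd * ⟪M e.2.1, v.2.2⟫ ≤ K ^ 2 * ‖e.2.1‖ ^ 2 + K ^ 2 * ‖e.2.1‖ * ‖e.1 + Q e.2.1‖ := by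
  have hMu := M.le_of_opNorm_le hM e.2.1
  have hSy := S.le_of_opNorm_le hS (e.1 + Q e.2.1)
  calc τd * ⟪M e.2.1, v.2.2⟫ = ⟪M e.2.1, M e.2.1⟫ + ⟪M e.2.1, S (e.1 + Q e.2.1)⟫ := by
        rw [← real_inner_smul_right, h.dual, inner_add_right]
    _ ≤ (K * ‖e.2.1‖) * (K * ‖e.2.1‖) + (K * ‖e.2.1‖) * (K * ‖e.1 + Q e.2.1‖) :=
        add_le_add ((real_inner_le_norm _ _).trans (by gcongr))
          ((real_inner_le_norm _ _).trans (by gcongr))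
    _ = _ := by ring

lemma lyapunovForm_add_flip_le (h : IsDeviationDynamics A Q M S κ K τp τd e v g d)
    (hB : LoopBounds A Θ Q M S K k σ) (hT : TuningConstants K k κ σ c τ) (hτp : τ < τp)
    (hτd : τ < τd) :
    lyapunovForm Θ Q M τp τd (c * min τp τd) e v + lyapunovForm Θ Q M τp τd (c * min τp τd) v e
      ≤ -(k * τp / 2 * ‖e.1 + Q e.2.1‖ ^ 2 + κ / 4 * ‖e.2.1‖ ^ 2
        + c * min τp τd / τp * σ / 2 * ‖e.2.2‖ ^ 2) := by
  have hp₀ : 0 < τp := hT.τ_pos.trans hτp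
  have hd₀ : 0 < τd := hT.τ_pos.trans hτd
  have hε₀ : 0 < c * min τp τd := mul_pos hT.c_pos (lt_min hp₀ hd₀)
  have hK₀ := hT.K_pos.le
  have hc₀ := hT.c_pos.le
  refine le_trans ?_ (hT.scalar_decrease (ρ := c * min τp τd / τp) (β := c * min τp τd / τd)
    hτp.le (by positivity) (div_le_of_le_mul₀ hp₀.le hc₀ ?_) (div_le_of_le_mul₀ hd₀.le hc₀ ?_) ?_
    (norm_nonneg _) (norm_nonneg _) (norm_nonneg _))
  · have hprimal : c * min τp τd * ⟪M v.2.1, e.2.2⟫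
        = c * min τp τd / τp * (τp * ⟪M v.2.1, e.2.2⟫) := by field_simp
    have hdual : c * min τp τd * ⟪M e.2.1, v.2.2⟫
        = c * min τp τd / τd * (τd * ⟪M e.2.1, v.2.2⟫) := by field_simp
    rw [lyapunovForm_add_flip hB.isLyapunovOperator.isSymmetric, mul_add, hprimal, hdual,
      ← add_assoc]
    gcongr ?_ + ?_ + _ * ?_ + _ * ?_
    · exact h.two_mul_inner_state_le hB hK₀ hp₀
    · exact h.energy_le hB.norm_S_le
    · exact h.cross_primal_le hB hK₀
    · exact h.cross_dual_le hB.norm_M_le hB.norm_S_le hK₀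
  · gcongr
    exact min_le_left _ _
  · gcongr
    exact min_le_right _ _
  · rw [div_mul_cancel₀ _ hp₀.ne']
    gcongr
    exact le_min hτp.le hτd.le

lemma lyapunovForm_add_flip_le_norm_sq (h : IsDeviationDynamics A Q M S κ K τp τd e v g d)
    (hB : LoopBounds A Θ Q M S K k σ) (hT : TuningConstants K k κ σ c τ) (hτp : τ < τp)
    (hτd : τ < τd) :
    lyapunovForm Θ Q M τp τd (c * min τp τd) e v + lyapunovForm Θ Q M τp τd (c * min τp τd) v e
      ≤ -(min (k * τp / 2) (min (κ / 4) (c * min τp τd / τp * σ / 2)) / (2 + 2 * ‖Q‖ ^ 2))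
        * ‖e‖ ^ 2 := by
  have hp₀ : 0 < τp := hT.τ_pos.trans hτp
  have hm₀ : 0 < min τp τd := lt_min hp₀ (hT.τ_pos.trans hτd)
  have ⟨_, hk, hκ, hσ, hc, _, _, _, _, _, _⟩ := hT
  refine (h.lyapunovForm_add_flip_le hB hT hτp hτd).trans ?_
  have hnorm := norm_sq_le_deviation Q e
  set a := k * τp / 2
  set b := κ / 4
  set l := c * min τp τd / τp * σ / 2
  have : 0 ≤ min a (min b l) := by positivity
  rw [neg_mul, neg_le_neg_iff, div_mul_eq_mul_div, div_le_iff₀ (by positivity)]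
  calc min a (min b l) * ‖e‖ ^ 2
      ≤ min a (min b l) * ((2 + 2 * ‖Q‖ ^ 2)
        * (‖e.1 + Q e.2.1‖ ^ 2 + ‖e.2.1‖ ^ 2 + ‖e.2.2‖ ^ 2)) := by gcongr
    _ = (min a (min b l) * ‖e.1 + Q e.2.1‖ ^ 2 + min a (min b l) * ‖e.2.1‖ ^ 2
        + min a (min b l) * ‖e.2.2‖ ^ 2) * (2 + 2 * ‖Q‖ ^ 2) := by ring
    _ ≤ _ := by gcongr <;> simp

end IsDeviationDynamics

theorem exists_forall_isLocallyExpStable [CompleteSpace E] {A Θ : E →L[ℝ] E} {k κ σ : ℝ}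
    (hk : 0 < k) (hκ : 0 < κ) (hσ : 0 < σ) (hΘ : IsLyapunovOperator A Θ k) (Q : F →L[ℝ] E)
    {M : F →L[ℝ] H} (hM : ∀ μ, σ * ‖μ‖ ^ 2 ≤ ‖M.adjoint μ‖ ^ 2) (S : E →L[ℝ] H) (L : ℝ) :
    ∃ τ > 0, ∀ τp τd, τ < τp → τ < τd → ∀ (V : E × F × H → E × F × H) (D : Set (E × F × H)) p,
      IsEquilibrium V D p → ∀ r > 0, closedBall p r ⊆ D → ∀ K : ℝ≥0,
      LipschitzOnWith K V (closedBall p r) →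
      (∀ s ∈ closedBall p r, ∃ g d, IsDeviationDynamics A Q M S κ L τp τd (s - p) (V s) g d) →
      IsLocallyExpStable V D p := by
  obtain ⟨K, hK₁, hΘQ, hMK, hSK, hLK⟩ :
      ∃ K : ℝ, 1 ≤ K ∧ ‖Θ‖ * ‖Q‖ ≤ K ∧ ‖M‖ ≤ K ∧ ‖S‖ ≤ K ∧ L ≤ K :=
    ⟨max 1 (max (‖Θ‖ * ‖Q‖) (max ‖M‖ (max ‖S‖ L))), by simp⟩
  obtain ⟨c, τ, hT⟩ := exists_tuningConstants hK₁ hk hκ hσ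
  have hB : LoopBounds A Θ Q M S K k σ := ⟨hΘ, hΘQ, hMK, hSK, hM⟩
  have hcK : 4 * c * K ≤ 1 := by
    simpa using (hT.four_mul_c_mul_pow_le (j := 1) (by norm_num)).trans hT.c_le_one
  refine ⟨τ, hT.τ_pos, fun τp τd hτp hτd V D p hp r hr hD KV hV hdyn => ?_⟩
  have hp₀ : 0 < τp := hT.τ_pos.trans hτp
  have hd₀ : 0 < τd := hT.τ_pos.trans hτd
  have : 0 < min τp τd := lt_min hp₀ hd₀
  have hc₀ := hT.c_pos
  refine isLocallyExpStable_of_bilinear_lyapunov hp hr hD hV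
    (lyapunovForm Θ Q M τp τd (c * min τp τd))
    (c := min τp τd / 4 / (2 + 2 * ‖Q‖ ^ 2))
    (rate := min (k * τp / 2) (min (κ / 4) (c * min τp τd / τp * σ / 2)) / (2 + 2 * ‖Q‖ ^ 2))
    (by positivity) (by positivity)
    (mul_norm_sq_le_lyapunovForm hΘ Q hMK hc₀.le hcK hp₀ hd₀) fun s hs => ?_
  obtain ⟨g, d, h⟩ := hdyn s hs
  exact (h.mono hLK).lyapunovForm_add_flip_le_norm_sq hB hT hτp hτd

end LoopLyapunov

section StrongMonotonicity

variable {F : Type*} [NormedAddCommGroup F] [InnerProductSpace ℝ F]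

/-- The map `g` is strongly monotone on `s` with modulus `κ`: the property of the gradients of
strongly convex functions on which uniqueness and stability of optimal points rest. -/
def StronglyMonotoneOn (s : Set F) (κ : ℝ) (g : F → F) : Prop :=
  ∀ x ∈ s, ∀ y ∈ s, κ * ‖x - y‖ ^ 2 ≤ ⟪g x - g y, x - y⟫

lemma StronglyMonotoneOn.mul_norm_sub_le {s : Set F} {κ : ℝ} {g : F → F}
    (hg : StronglyMonotoneOn s κ g) {x y h : F} (hx : x ∈ s) (hy : y ∈ s)
    (horth : ⟪g y - h, x - y⟫ = 0) : κ * ‖x - y‖ ≤ ‖g x - h‖ := by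
  rcases (norm_nonneg (x - y)).eq_or_lt with h₀ | h₀
  · simp only [← h₀, mul_zero, norm_nonneg]
  · refine le_of_mul_le_mul_right ?_ h₀
    calc κ * ‖x - y‖ * ‖x - y‖ = κ * ‖x - y‖ ^ 2 := by ring
      _ ≤ ⟪g x - g y, x - y⟫ := hg x hx y hy
      _ = ⟪g x - h, x - y⟫ := by
        rw [← sub_sub_sub_cancel_right (g x) (g y) h, inner_sub_left, horth, sub_zero]
      _ ≤ ‖g x - h‖ * ‖x - y‖ := real_inner_le_norm _ _

variable [CompleteSpace F] {s t : Set F} {κ : ℝ} {f : F → ℝ}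

lemma inner_sub_le_sub_of_convexOn {f' x y : F} (hf : ConvexOn ℝ s f) (hx : x ∈ s) (hy : y ∈ s)
    (hd : HasGradientAt f f' x) : ⟪f', y - x⟫ ≤ f y - f x := by
  have hline : ConvexOn ℝ _ (f ∘ AffineMap.lineMap x y : ℝ → ℝ) :=
    hf.comp_affineMap (AffineMap.lineMap x y)
  have hderiv : HasDerivAt (f ∘ AffineMap.lineMap x y : ℝ → ℝ) ⟪f', y - x⟫ 0 := by
    have hd₀ : HasFDerivAt f (InnerProductSpace.toDual ℝ F f') (AffineMap.lineMap x y (0 : ℝ)) := by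
      simpa only [AffineMap.lineMap_apply_zero] using hd.hasFDerivAt
    exact hd₀.comp_hasDerivAt 0 AffineMap.hasDerivAt_lineMap
  have hslope := hline.le_slope_of_hasDerivAt (x := 0) (y := 1) (by simpa using hx)
    (by simpa using hy) zero_lt_one hderiv
  simpa [slope_def_field] using hslope

lemma stronglyMonotoneOn_of_strongConvexOn (hf : StrongConvexOn s κ f) (hts : t ⊆ s) {g : F → F}
    (hg : ∀ x ∈ t, HasGradientAt f (g x) x) : StronglyMonotoneOn t κ g := by
  have hconv := strongConvexOn_iff_convex.1 hf
  have hgrad : ∀ x ∈ t, HasGradientAt (fun x => f x - κ / 2 * ‖x‖ ^ 2) (g x - κ • x) x := by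
    intro x hx
    rw [hasGradientAt_iff_hasFDerivAt]
    refine ((hg x hx).hasFDerivAt.sub
      ((hasStrictFDerivAt_norm_sq x).hasFDerivAt.const_mul (κ / 2))).congr_fderiv ?_
    ext v
    simp
    ring
  intro x hx y hy
  have hxy := inner_sub_le_sub_of_convexOn hconv (hts hx) (hts hy) (hgrad x hx)
  have hyx := inner_sub_le_sub_of_convexOn hconv (hts hy) (hts hx) (hgrad y hy)
  rw [← neg_sub x y, inner_neg_right] at hxy
  have hsum : 0 ≤ ⟪(g x - κ • x) - (g y - κ • y), x - y⟫ := by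
    rw [inner_sub_left]
    linarith
  rw [sub_sub_sub_comm, ← smul_sub, inner_sub_left, real_inner_smul_left,
    real_inner_self_eq_norm_sq] at hsum
  linarith

end StrongMonotonicity

lemma exists_lipschitzOnWith_ball_of_isCompact {X Y : Type*} [PseudoMetricSpace X] [ProperSpace X]
    [PseudoMetricSpace Y] {s O : Set X} (hs : IsCompact s) (hO : IsOpen O) (hsO : s ⊆ O)
    {f : X → Y} (hf : LocallyLipschitzOn O f) :
    ∃ L : ℝ≥0, ∃ ρ > 0, ∀ x ∈ s, LipschitzOnWith L f (ball x ρ) := by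
  obtain ⟨ρ, hρ, hρO⟩ := hs.exists_cthickening_subset_open hO hsO
  obtain ⟨L, hL⟩ := (hf.mono hρO).exists_lipschitzOnWith_of_compact hs.cthickening
  exact ⟨L, ρ, hρ, fun x hx =>
    hL.mono ((ball_subset_thickening hx ρ).trans (thickening_subset_cthickening ρ s))⟩

section Adjoint

variable {F H : Type*} [NormedAddCommGroup F] [InnerProductSpace ℝ F] [CompleteSpace F]
  [NormedAddCommGroup H] [InnerProductSpace ℝ H] [CompleteSpace H] {M : F →L[ℝ] H}

lemma exists_mul_norm_sq_le_norm_adjoint_sq (hM : Function.Surjective M) :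
    ∃ σ > 0, ∀ μ, σ * ‖μ‖ ^ 2 ≤ ‖M.adjoint μ‖ ^ 2 := by
  obtain ⟨K, hK, hpre⟩ := M.exists_preimage_norm_le hM
  refine ⟨(K ^ 2)⁻¹, by positivity, fun μ => ?_⟩
  obtain ⟨u, rfl, hu⟩ := hpre μ
  have hle : ‖M u‖ ^ 2 ≤ ‖M.adjoint (M u)‖ * (K * ‖M u‖) := calc
    ‖M u‖ ^ 2 = ⟪M.adjoint (M u), u⟫ := by
      rw [ContinuousLinearMap.adjoint_inner_left, real_inner_self_eq_norm_sq]
    _ ≤ ‖M.adjoint (M u)‖ * ‖u‖ := real_inner_le_norm _ _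
    _ ≤ ‖M.adjoint (M u)‖ * (K * ‖M u‖) := by gcongr
  have hbound : ‖M u‖ ≤ K * ‖M.adjoint (M u)‖ := by
    rcases (norm_nonneg (M u)).eq_or_lt with h | h
    · rw [← h]
      positivity
    · exact le_of_mul_le_mul_right (by linarith) h
  rw [inv_mul_le_iff₀ (by positivity), ← mul_pow]
  gcongr

lemma adjoint_injective_of_surjective (hM : Function.Surjective M) :
    Function.Injective M.adjoint := by
  rw [injective_iff_map_eq_zero]
  intro μ hμ
  obtain ⟨u, rfl⟩ := hM μ
  rw [← inner_self_eq_zero (𝕜 := ℝ), ← ContinuousLinearMap.adjoint_inner_left, hμ,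
    inner_zero_left]

lemma exists_add_adjoint_eq_zero [FiniteDimensional ℝ H] {g : F}
    (hg : ∀ v, M v = 0 → ⟪g, v⟫ = 0) : ∃ μ, g + M.adjoint μ = 0 := by
  have hmem : g ∈ M.kerᗮ := by
    rw [Submodule.mem_orthogonal']
    exact hg
  rw [ContinuousLinearMap.orthogonal_ker,
    (Submodule.closed_of_finiteDimensional _).submodule_topologicalClosure_eq] at hmem
  obtain ⟨μ, rfl⟩ := hmem
  exact ⟨-μ, by rw [map_neg]; exact add_neg_cancel _⟩

end Adjoint

namespace Problem

variable {n m r nw nc : ℕ} {P : Problem n m r nw nc} {w w₀ : Vec nw} {u u₀ : Vec m}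
  {μ μ₀ : Vec nc} {κ : ℝ}

/-- The steady-state constraint operator `H_z G_u + H_u`, acting on the input. -/
noncomputable def cstr (P : Problem n m r nw nc) : Vec m →L[ℝ] Vec nc :=
  actL (P.Hz * P.Gu + P.Hu)

/-- The effect `H_z G_w + H_w` of the disturbance on the steady-state constraint. -/
noncomputable def cstrDist (P : Problem n m r nw nc) : Vec nw →L[ℝ] Vec nc :=
  actL (P.Hz * P.Gw + P.Hw)

/-- The steady-state objective as a function of the input alone. -/
noncomputable def cost (P : Problem n m r nw nc) (w : Vec nw) (u : Vec m) : ℝ :=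
  P.f₀ u + P.g₀ (P.steadyOutput w u)

/-- The gradient of `Problem.cost` at the inputs in `Problem.interiorInputs`, in the form in which
it enters the primal-dual controller. -/
noncomputable def costGrad (P : Problem n m r nw nc) (w : Vec nw) (u : Vec m) : Vec m :=
  ∇ P.f₀ u + (actL P.Gu).adjoint (∇ P.g₀ (P.steadyOutput w u))

/-- The inputs `u ∈ int U` with steady-state output in `int Z`. -/
def interiorInputs (P : Problem n m r nw nc) (w : Vec nw) : Set (Vec m) :=
  {u | u ∈ interior P.U ∧ P.steadyOutput w u ∈ interior P.Z}

/-- The Karush-Kuhn-Tucker conditions for an interior input `u` and a multiplier `μ` of the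
equality constraint. -/
structure IsKKT (P : Problem n m r nw nc) (w : Vec nw) (u : Vec m) (μ : Vec nc) : Prop where
  mem : u ∈ P.interiorInputs w
  stationary : P.costGrad w u + P.cstr.adjoint μ = 0
  feasible : P.cstr u + P.cstrDist w = 0

lemma continuous_steadyOutput (P : Problem n m r nw nc) :
    Continuous fun q : Vec nw × Vec m => P.steadyOutput q.1 q.2 := by
  simp only [steadyOutput, act_eq_actL]
  fun_prop

lemma violation_steadyOutput (P : Problem n m r nw nc) (w : Vec nw) (u : Vec m) :
    P.violation w u (P.steadyOutput w u) = P.cstr u + P.cstrDist w := by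
  simp only [violation, steadyOutput, cstr, cstrDist, act_eq_actL, map_add, actL_mul, add_apply,
    ContinuousLinearMap.comp_apply]
  abel

lemma eventually_mem_interiorInputs (hu : u ∈ P.interiorInputs w) :
    ∀ᶠ q : Vec nw × Vec m in 𝓝 (w, u), q.2 ∈ P.interiorInputs q.1 :=
  (continuous_snd.continuousAt.eventually (isOpen_interior.mem_nhds hu.1)).and
    (P.continuous_steadyOutput.continuousAt.eventually (isOpen_interior.mem_nhds hu.2))

lemma cstr_surjective (hrank : (P.Hz * P.Gu + P.Hu).rank = nc) : Function.Surjective P.cstr := by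
  refine LinearMap.range_eq_top.1 (Submodule.eq_top_of_finrank_eq (.trans ?_
    (hrank.trans finrank_euclideanSpace_fin.symm)))
  rw [Matrix.rank_eq_finrank_range_toLin _ (EuclideanSpace.basisFun (Fin nc) ℝ).toBasis
    (EuclideanSpace.basisFun (Fin m) ℝ).toBasis]
  rfl

section Optimality

lemma hasGradientAt_cost (hf : DifferentiableOn ℝ P.f₀ (interior P.U))
    (hg : DifferentiableOn ℝ P.g₀ (interior P.Z)) (hu : u ∈ P.interiorInputs w) :
    HasGradientAt (P.cost w) (P.costGrad w u) u := by
  have hf' := (hf.hasGradientAt (isOpen_interior.mem_nhds hu.1)).hasFDerivAt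
  have hg' := (hg.hasGradientAt (isOpen_interior.mem_nhds hu.2)).hasFDerivAt
  have hz : HasFDerivAt (P.steadyOutput w) (actL P.Gu) u :=
    (actL P.Gu).hasFDerivAt.add_const (act P.Gw w)
  rw [hasGradientAt_iff_hasFDerivAt]
  refine (hf'.add (hg'.comp u hz)).congr_fderiv ?_
  ext v
  simp [costGrad, ContinuousLinearMap.adjoint_inner_left]

lemma stronglyMonotoneOn_costGrad (hf : DifferentiableOn ℝ P.f₀ (interior P.U))
    (hg : DifferentiableOn ℝ P.g₀ (interior P.Z))
    (hκ : StrongConvexOn {u | u ∈ P.U ∧ P.steadyOutput w u ∈ P.Z} κ (P.cost w)) :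
    StronglyMonotoneOn (P.interiorInputs w) κ (P.costGrad w) :=
  stronglyMonotoneOn_of_strongConvexOn hκ
    (fun _ hu => ⟨interior_subset hu.1, interior_subset hu.2⟩)
    fun _ hu => hasGradientAt_cost hf hg hu

lemma IsOptimal.isLocalMin_cost_add_smul (hopt : P.IsOptimal w u (P.steadyOutput w u))
    (hu : u ∈ P.interiorInputs w) {v : Vec m} (hv : P.cstr v = 0) :
    IsLocalMin (fun t : ℝ => P.cost w (u + t • v)) 0 := by
  have hline : Tendsto (fun t : ℝ => (w, u + t • v)) (𝓝 0) (𝓝 (w, u)) :=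
    Continuous.tendsto' (by fun_prop) _ _ (by simp)
  filter_upwards [hline.eventually (eventually_mem_interiorInputs hu)] with t ht
  have hfeas : P.violation w (u + t • v) (P.steadyOutput w (u + t • v)) = 0 := by
    rw [violation_steadyOutput, map_add, map_smul, hv, smul_zero, add_zero,
      ← violation_steadyOutput]
    exact hopt.1.2.2.2
  simpa [cost] using hopt.2 (u + t • v) _ ⟨interior_subset ht.1, interior_subset ht.2, rfl, hfeas⟩

lemma IsOptimal.exists_isKKT (hf : DifferentiableOn ℝ P.f₀ (interior P.U))
    (hg : DifferentiableOn ℝ P.g₀ (interior P.Z))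
    (hopt : P.IsOptimal w u (P.steadyOutput w u)) (hu : u ∈ P.interiorInputs w) :
    ∃ μ, P.IsKKT w u μ := by
  have hstat : ∀ v, P.cstr v = 0 → ⟪P.costGrad w u, v⟫ = 0 := fun v hv =>
    (hopt.isLocalMin_cost_add_smul hu hv).hasDerivAt_eq_zero
      ((hasGradientAt_cost hf hg hu).hasFDerivAt.hasLineDerivAt v)
  obtain ⟨μ, hμ⟩ := exists_add_adjoint_eq_zero hstat
  exact ⟨μ, hu, hμ, by rw [← violation_steadyOutput]; exact hopt.1.2.2.2⟩

lemma exists_isOptimal_and_isKKT (hf : DifferentiableOn ℝ P.f₀ (interior P.U))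
    (hg : DifferentiableOn ℝ P.g₀ (interior P.Z))
    (hopt : ∃ u ∈ interior P.U, ∃ z ∈ interior P.Z, P.IsOptimal w u z) :
    ∃ u μ, P.IsOptimal w u (P.steadyOutput w u) ∧ P.IsKKT w u μ := by
  obtain ⟨u, hu, z, hz, hopt⟩ := hopt
  obtain rfl := hopt.1.2.2.1
  obtain ⟨μ, hkkt⟩ := hopt.exists_isKKT hf hg ⟨hu, hz⟩
  exact ⟨u, μ, hopt, hkkt⟩

end Optimality

section Sensitivity

lemma IsKKT.inner_costGrad_eq_zero (h : P.IsKKT w u μ) {v : Vec m} (hv : P.cstr v = 0) :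
    ⟪P.costGrad w u, v⟫ = 0 := by
  rw [eq_neg_of_add_eq_zero_left h.stationary, inner_neg_left,
    ContinuousLinearMap.adjoint_inner_left, hv, inner_zero_right, neg_zero]

lemma IsKKT.mul_norm_sub_le (hmono : StronglyMonotoneOn (P.interiorInputs w) κ (P.costGrad w))
    (h : P.IsKKT w u μ) (h₀ : P.IsKKT w₀ u₀ μ₀) {v : Vec m} (hv : v ∈ P.interiorInputs w)
    (hfeas : P.cstr v + P.cstrDist w = 0) :
    κ * ‖v - u‖ ≤ ‖P.costGrad w v - P.costGrad w₀ u₀‖ := by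
  have hker : P.cstr (v - u) = 0 := by
    rw [map_sub, sub_eq_zero]
    exact add_right_cancel (hfeas.trans h.feasible.symm)
  refine hmono.mul_norm_sub_le hv h.mem ?_
  rw [inner_sub_left, h.inner_costGrad_eq_zero hker, h₀.inner_costGrad_eq_zero hker, sub_zero]

lemma IsKKT.unique (hκ : 0 < κ) (hsurj : Function.Surjective P.cstr)
    (hmono : StronglyMonotoneOn (P.interiorInputs w) κ (P.costGrad w))
    (h : P.IsKKT w u μ) (h₀ : P.IsKKT w u₀ μ₀) : u = u₀ ∧ μ = μ₀ := by
  have hu : u = u₀ := by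
    have hle := h₀.mul_norm_sub_le hmono h h.mem h.feasible
    rw [sub_self, norm_zero] at hle
    exact sub_eq_zero.1 (norm_le_zero_iff.1 (nonpos_of_mul_nonpos_right hle hκ))
  subst hu
  exact ⟨rfl, adjoint_injective_of_surjective hsurj
    (add_left_cancel (h.stationary.trans h₀.stationary.symm))⟩

lemma continuousAt_costGrad (hf : ContinuousOn (∇ P.f₀) (interior P.U))
    (hg : ContinuousOn (∇ P.g₀) (interior P.Z)) (hu : u ∈ P.interiorInputs w) :
    ContinuousAt (fun q : Vec nw × Vec m => P.costGrad q.1 q.2) (w, u) := by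
  have hf' : ContinuousAt (∇ P.f₀) u := hf.continuousAt (isOpen_interior.mem_nhds hu.1)
  have hg' : ContinuousAt (∇ P.g₀) (P.steadyOutput w u) :=
    hg.continuousAt (isOpen_interior.mem_nhds hu.2)
  have hgz : ContinuousAt (fun q : Vec nw × Vec m => ∇ P.g₀ (P.steadyOutput q.1 q.2)) (w, u) :=
    hg'.comp_of_eq P.continuous_steadyOutput.continuousAt rfl
  have hfu : ContinuousAt (fun q : Vec nw × Vec m => ∇ P.f₀ q.2) (w, u) :=
    hf'.comp_of_eq continuousAt_snd rfl
  simp only [costGrad]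
  fun_prop

variable {W : Set (Vec nw)} {ub : Vec nw → Vec m} {μb : Vec nw → Vec nc}

-- Moving `ub w₀` along a right inverse of the constraint operator gives a continuous feasible
-- candidate `v w`, and strong monotonicity bounds the distance from `v w` to `ub w`.
lemma continuousOn_of_isKKT (hκ : 0 < κ) (hsurj : Function.Surjective P.cstr)
    (hmono : ∀ w ∈ W, StronglyMonotoneOn (P.interiorInputs w) κ (P.costGrad w))
    (hf : ContinuousOn (∇ P.f₀) (interior P.U)) (hg : ContinuousOn (∇ P.g₀) (interior P.Z))
    (hkkt : ∀ w ∈ W, P.IsKKT w (ub w) (μb w)) : ContinuousOn ub W := by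
  intro w₀ hw₀
  obtain ⟨R, hR⟩ := P.cstr.exists_rightInverse_of_surjective (LinearMap.range_eq_top.2 hsurj)
  have hR' : ∀ e, P.cstr (R e) = e := DFunLike.congr_fun hR
  set v : Vec nw → Vec m := fun w => ub w₀ + R (P.cstrDist (w₀ - w)) with hv
  have hv₀ : v w₀ = ub w₀ := by simp [hv]
  have hfeas : ∀ w, P.cstr (v w) + P.cstrDist w = 0 := fun w => by
    rw [map_add, hR', map_sub, add_assoc, sub_add_cancel, (hkkt w₀ hw₀).feasible]
  have hvlim : Tendsto (fun w => (w, v w)) (𝓝 w₀) (𝓝 (w₀, ub w₀)) :=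
    Continuous.tendsto' (by fun_prop) _ _ (by rw [hv₀])
  have hbound : ∀ᶠ w in 𝓝[W] w₀,
      ‖v w - ub w‖ ≤ κ⁻¹ * ‖P.costGrad w (v w) - P.costGrad w₀ (ub w₀)‖ := by
    filter_upwards [mem_nhdsWithin_of_mem_nhds
      (hvlim.eventually (eventually_mem_interiorInputs (hkkt w₀ hw₀).mem)),
      self_mem_nhdsWithin] with w hw hwW
    rw [← div_eq_inv_mul, le_div_iff₀' hκ]
    exact (hkkt w hwW).mul_norm_sub_le (hmono w hwW) (hkkt w₀ hw₀) hw (hfeas w)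
  have hgrad : Tendsto (fun w => κ⁻¹ * ‖P.costGrad w (v w) - P.costGrad w₀ (ub w₀)‖)
      (𝓝 w₀) (𝓝 0) := by
    simpa using ((((continuousAt_costGrad hf hg (hkkt w₀ hw₀).mem).tendsto.comp hvlim).sub_const
      (P.costGrad w₀ (ub w₀))).norm).const_mul κ⁻¹
  have hdiff := squeeze_zero_norm' hbound (hgrad.mono_left nhdsWithin_le_nhds)
  have hvw : Tendsto v (𝓝[W] w₀) (𝓝 (ub w₀)) :=
    (Continuous.tendsto' (by fun_prop) _ _ hv₀).mono_left nhdsWithin_le_nhds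
  simpa only [ContinuousWithinAt, sub_sub_cancel, sub_zero] using hvw.sub hdiff

lemma exists_lipschitzOnWith_gradient_ball (hW : IsCompact W) (hub : ContinuousOn ub W)
    (hint : ∀ w ∈ W, ub w ∈ P.interiorInputs w)
    (hf : LocallyLipschitzOn (interior P.U) (∇ P.f₀))
    (hg : LocallyLipschitzOn (interior P.Z) (∇ P.g₀)) :
    ∃ Lf Lg : ℝ≥0, ∃ ρ > 0, ∀ w ∈ W, LipschitzOnWith Lf (∇ P.f₀) (ball (ub w) ρ) ∧
      LipschitzOnWith Lg (∇ P.g₀) (ball (P.steadyOutput w (ub w)) ρ) := by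
  have hzb : ContinuousOn (fun w => P.steadyOutput w (ub w)) W := by
    simp only [steadyOutput, act_eq_actL]
    fun_prop
  obtain ⟨Lf, ρf, hρf, hLf⟩ := exists_lipschitzOnWith_ball_of_isCompact
    (hW.image_of_continuousOn hub) isOpen_interior (image_subset_iff.2 fun w hw => (hint w hw).1) hf
  obtain ⟨Lg, ρg, hρg, hLg⟩ := exists_lipschitzOnWith_ball_of_isCompact
    (hW.image_of_continuousOn hzb) isOpen_interior (image_subset_iff.2 fun w hw => (hint w hw).2) hg
  refine ⟨Lf, Lg, min ρf ρg, lt_min hρf hρg, fun w hw => ⟨?_, ?_⟩⟩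
  · exact (hLf (ub w) ⟨w, hw, rfl⟩).mono (ball_subset_ball (min_le_left _ _))
  · exact (hLg (P.steadyOutput w (ub w)) ⟨w, hw, rfl⟩).mono (ball_subset_ball (min_le_right _ _))

end Sensitivity

section SteadyState

/-- The sensitivity `A⁻¹ B` of the steady state to the input, up to sign. -/
noncomputable def stateGain (P : Problem n m r nw nc) : Vec m →L[ℝ] Vec n :=
  actL (P.A⁻¹ * P.B)

/-- The steady state `-A⁻¹ (B u + B_w w)` of the plant under a constant input. -/
noncomputable def steadyState (P : Problem n m r nw nc) (w : Vec nw) (u : Vec m) : Vec n :=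
  -(P.stateGain u + actL (P.A⁻¹ * P.Bw) w)

lemma stateField_eq (hA : IsHurwitz P.A) (w : Vec nw) (x : Vec n) (u : Vec m) :
    P.stateField w x u = actL P.A (x - P.steadyState w u) := by
  simp only [stateField, steadyState, stateGain, act_eq_actL, actL_mul,
    ContinuousLinearMap.comp_apply, map_sub, map_neg, map_add, actL_actL_inv hA.isUnit]
  abel

lemma stateField_eq_zero_iff (hA : IsHurwitz P.A) {x : Vec n} :
    P.stateField w x u = 0 ↔ x = P.steadyState w u := by
  rw [stateField_eq hA, ← sub_eq_zero (a := x)]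
  exact map_eq_zero_iff _ (Function.LeftInverse.injective (actL_inv_actL hA.isUnit))

lemma plantOutput_eq (P : Problem n m r nw nc) (w : Vec nw) (x : Vec n) (u : Vec m) :
    P.plantOutput w x u = P.steadyOutput w u + actL P.C (x - P.steadyState w u) := by
  simp only [plantOutput, steadyOutput, steadyState, stateGain, Gu, Gw, act_eq_actL, actL_mul,
    ContinuousLinearMap.comp_apply, map_sub, map_neg, map_add, add_apply, neg_apply]
  abel

lemma violation_plantOutput (P : Problem n m r nw nc) (w : Vec nw) (x : Vec n) (u : Vec m) :
    P.violation w u (P.plantOutput w x u) = P.cstr u + P.cstrDist w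
      + (actL P.Hz).comp (actL P.C) (x - P.steadyState w u) := by
  rw [← violation_steadyOutput, plantOutput_eq]
  simp only [violation, act_eq_actL, map_add, ContinuousLinearMap.comp_apply]
  abel

lemma plantOutput_steadyState (P : Problem n m r nw nc) (w : Vec nw) (u : Vec m) :
    P.plantOutput w (P.steadyState w u) u = P.steadyOutput w u := by
  rw [plantOutput_eq, sub_self, map_zero, add_zero]

lemma sub_steadyState (P : Problem n m r nw nc) (w : Vec nw) (x : Vec n) (u u₀ : Vec m) :
    x - P.steadyState w u = (x - P.steadyState w u₀) + P.stateGain (u - u₀) := by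
  simp only [steadyState, map_sub]
  abel

end SteadyState

end Problem

section PrimalDual

open Problem

variable {n m r nw nc : ℕ} {P : Problem n m r nw nc} {w : Vec nw} {κ τp τd : ℝ}

lemma primalDual_loopField (P : Problem n m r nw nc) (τp τd : ℝ) (w : Vec nw)
    (s : Vec n × (Vec m × Vec nc)) :
    (primalDual P τp τd).loopField P w s = (P.stateField w s.1 s.2.1,
      τp⁻¹ • (-∇ P.f₀ s.2.1 - (actL P.Gu).adjoint (∇ P.g₀ (P.plantOutput w s.1 s.2.1))
        - P.cstr.adjoint s.2.2),
      τd⁻¹ • P.violation w s.2.1 (P.plantOutput w s.1 s.2.1)) := by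
  simp only [Controller.loopField, Controller.loopOutput, primalDual, act_eq_actL, actL_transpose,
    cstr]

lemma mem_primalDual_loopDomain {s : Vec n × (Vec m × Vec nc)} :
    s ∈ (primalDual P τp τd).loopDomain P w ↔
      s.2.1 ∈ interior P.U ∧ P.plantOutput w s.1 s.2.1 ∈ interior P.Z := Iff.rfl

lemma primalDual_isEquilibrium_iff (hA : IsHurwitz P.A) (hτp : 0 < τp) (hτd : 0 < τd)
    {s : Vec n × (Vec m × Vec nc)} :
    IsEquilibrium ((primalDual P τp τd).loopField P w) ((primalDual P τp τd).loopDomain P w) s ↔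
      s.1 = P.steadyState w s.2.1 ∧ P.IsKKT w s.2.1 s.2.2 := by
  obtain ⟨x, u, μ⟩ := s
  have hneg (a b c : Vec m) : -a - b - c = 0 ↔ a + b + c = 0 := by
    rw [← neg_eq_zero, show -(-a - b - c) = a + b + c by abel]
  simp only [IsEquilibrium, mem_primalDual_loopDomain, primalDual_loopField, Prod.mk_eq_zero,
    smul_eq_zero, inv_eq_zero, hτp.ne', hτd.ne', false_or, stateField_eq_zero_iff hA, hneg]
  constructor
  · rintro ⟨⟨hu, hz⟩, rfl, hstat, hviol⟩
    rw [plantOutput_steadyState] at hz hstat hviol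
    exact ⟨rfl, ⟨hu, hz⟩, hstat, (P.violation_steadyOutput w u).symm.trans hviol⟩
  · rintro ⟨rfl, hu, hstat, hfeas⟩
    rw [plantOutput_steadyState]
    exact ⟨hu, rfl, hstat, (P.violation_steadyOutput w u).trans hfeas⟩

lemma eq_of_primalDual_isEquilibrium (hA : IsHurwitz P.A) (hτp : 0 < τp) (hτd : 0 < τd)
    (hκ : 0 < κ) (hsurj : Function.Surjective P.cstr)
    (hmono : StronglyMonotoneOn (P.interiorInputs w) κ (P.costGrad w))
    {s : Vec n × (Vec m × Vec nc)}
    (hs : IsEquilibrium ((primalDual P τp τd).loopField P w)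
      ((primalDual P τp τd).loopDomain P w) s)
    {u : Vec m} {μ : Vec nc} (hkkt : P.IsKKT w u μ) : s = (P.steadyState w u, u, μ) := by
  obtain ⟨x, v, ν⟩ := s
  obtain ⟨rfl, hkkt'⟩ : x = P.steadyState w v ∧ P.IsKKT w v ν :=
    (primalDual_isEquilibrium_iff hA hτp hτd).1 hs
  obtain ⟨rfl, rfl⟩ := hkkt'.unique hκ hsurj hmono hkkt
  rfl

section LocalEstimates

variable {T : Set (Vec n × (Vec m × Vec nc))} {Nf : Set (Vec m)} {Ng : Set (Vec r)} {Lf Lg : ℝ≥0}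

lemma primalDual_lipschitzOnWith (hf : LipschitzOnWith Lf (∇ P.f₀) Nf)
    (hg : LipschitzOnWith Lg (∇ P.g₀) Ng) (hTf : ∀ s ∈ T, s.2.1 ∈ Nf)
    (hTg : ∀ s ∈ T, P.plantOutput w s.1 s.2.1 ∈ Ng) :
    ∃ K, LipschitzOnWith K ((primalDual P τp τd).loopField P w) T := by
  let X := Vec n × (Vec m × Vec nc)
  let πx : X →L[ℝ] Vec n := .fst ℝ _ _
  let πu : X →L[ℝ] Vec m := (ContinuousLinearMap.fst ℝ _ _).comp (.snd ℝ _ _)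
  let πμ : X →L[ℝ] Vec nc := (ContinuousLinearMap.snd ℝ _ _).comp (.snd ℝ _ _)
  have affine {k : ℕ} (ℓ : X →L[ℝ] Vec k) (c : Vec k) :
      LipschitzOnWith ‖ℓ‖₊ (fun s => ℓ s + c) T :=
    (LipschitzWith.of_dist_le_mul fun s t => by
      simpa only [dist_add_right] using ℓ.lipschitz.dist_le_mul s t).lipschitzOnWith
  let ℓz := (actL P.C).comp πx + (actL P.D).comp πu
  have hx := affine ((actL P.A).comp πx + (actL P.B).comp πu) (act P.Bw w)
  have hfu := hf.comp πu.lipschitz.lipschitzOnWith hTf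
  have hgz := (actL P.Gu).adjoint.lipschitz.comp_lipschitzOnWith
    (hg.comp (affine ℓz (act P.Dw w)) hTg)
  have hu := (lipschitzWith_smul τp⁻¹).comp_lipschitzOnWith
    ((hfu.neg.sub hgz).sub (P.cstr.adjoint.comp πμ).lipschitz.lipschitzOnWith)
  have hμ := (lipschitzWith_smul τd⁻¹).comp_lipschitzOnWith
    (affine ((actL P.Hz).comp ℓz + (actL P.Hu).comp πu) (act P.Hz (act P.Dw w) + act P.Hw w))
  obtain ⟨K, hK⟩ : ∃ K, LipschitzOnWith K _ T := ⟨_, hx.prodMk (hu.prodMk hμ)⟩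
  refine ⟨K, ?_⟩
  convert hK using 1
  funext s
  rw [primalDual_loopField]
  refine Prod.ext rfl (Prod.ext rfl (congrArg (τd⁻¹ • ·) ?_))
  have hπx : πx s = s.1 := rfl
  have hπu : πu s = s.2.1 := rfl
  simp only [ℓz, hπx, hπu, violation, plantOutput, act_eq_actL, map_add,
    ContinuousLinearMap.comp_apply, add_apply]
  abel

lemma eventually_mem_near_steadyState {u : Vec m} {μ : Vec nc} (hNf : Nf ∈ 𝓝 u)
    (hNg : Ng ∈ 𝓝 (P.steadyOutput w u)) :
    ∀ᶠ s : Vec n × (Vec m × Vec nc) in 𝓝 (P.steadyState w u, u, μ), s.2.1 ∈ Nf ∧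
      P.steadyOutput w s.2.1 ∈ Ng ∧ P.plantOutput w s.1 s.2.1 ∈ Ng := by
  have hu : Tendsto (fun s : Vec n × (Vec m × Vec nc) => s.2.1)
      (𝓝 (P.steadyState w u, u, μ)) (𝓝 u) := Continuous.tendsto' (by fun_prop) _ _ rfl
  have hz : ContinuousAt (P.steadyOutput w) u :=
    (P.continuous_steadyOutput.comp (.prodMk_right w)).continuousAt
  have hy : Tendsto (fun s : Vec n × (Vec m × Vec nc) => P.plantOutput w s.1 s.2.1)
      (𝓝 (P.steadyState w u, u, μ)) (𝓝 (P.steadyOutput w u)) := by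
    refine Continuous.tendsto' ?_ _ _ (P.plantOutput_steadyState w u)
    simp only [plantOutput, act_eq_actL]
    fun_prop
  exact (hu.eventually_mem hNf).and
    ((hu.eventually (hz.eventually_mem hNg)).and (hy.eventually_mem hNg))

lemma norm_adjoint_gradient_sub_le (hg : LipschitzOnWith Lg (∇ P.g₀) Ng) {z z₀ : Vec r}
    (hz : z ∈ Ng) (hz₀ : z₀ ∈ Ng) :
    ‖(actL P.Gu).adjoint (∇ P.g₀ z - ∇ P.g₀ z₀)‖ ≤ ‖actL P.Gu‖ * (Lg * ‖z - z₀‖) := calc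
  _ ≤ ‖actL P.Gu‖ * ‖∇ P.g₀ z - ∇ P.g₀ z₀‖ :=
    (actL P.Gu).adjoint.le_of_opNorm_le (LinearIsometryEquiv.norm_map _ _).le _
  _ ≤ _ := by
    gcongr
    exact hg.norm_sub_le hz hz₀

lemma norm_costGrad_sub_le (hf : LipschitzOnWith Lf (∇ P.f₀) Nf)
    (hg : LipschitzOnWith Lg (∇ P.g₀) Ng) {u u₀ : Vec m} (hu : u ∈ Nf) (hu₀ : u₀ ∈ Nf)
    (hz : P.steadyOutput w u ∈ Ng) (hz₀ : P.steadyOutput w u₀ ∈ Ng) :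
    ‖P.costGrad w u - P.costGrad w u₀‖ ≤ (Lf + ‖actL P.Gu‖ * Lg * ‖actL P.Gu‖) * ‖u - u₀‖ := by
  have hout : P.steadyOutput w u - P.steadyOutput w u₀ = actL P.Gu (u - u₀) := by
    simp only [steadyOutput, act_eq_actL, map_sub, add_sub_add_right_eq_sub]
  have hgz := norm_adjoint_gradient_sub_le (P := P) hg hz hz₀
  rw [hout] at hgz
  rw [costGrad, costGrad, add_sub_add_comm, ← map_sub]
  calc _ ≤ Lf * ‖u - u₀‖ + ‖actL P.Gu‖ * (Lg * ‖actL P.Gu (u - u₀)‖) :=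
        norm_add_le_of_le (hf.norm_sub_le hu hu₀) hgz
    _ ≤ Lf * ‖u - u₀‖ + ‖actL P.Gu‖ * (Lg * (‖actL P.Gu‖ * ‖u - u₀‖)) := by
        gcongr
        exact (actL P.Gu).le_opNorm _
    _ = _ := by ring

lemma primalDual_isDeviationDynamics (hA : IsHurwitz P.A) (hτp : τp ≠ 0) (hτd : τd ≠ 0)
    (hmono : StronglyMonotoneOn (P.interiorInputs w) κ (P.costGrad w))
    (hf : LipschitzOnWith Lf (∇ P.f₀) Nf) (hg : LipschitzOnWith Lg (∇ P.g₀) Ng)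
    {u : Vec m} {μ : Vec nc} (hkkt : P.IsKKT w u μ) (hu : u ∈ Nf) (hz : P.steadyOutput w u ∈ Ng)
    {s : Vec n × (Vec m × Vec nc)} (hs : s.2.1 ∈ P.interiorInputs w) (hsu : s.2.1 ∈ Nf)
    (hsz : P.steadyOutput w s.2.1 ∈ Ng) (hsy : P.plantOutput w s.1 s.2.1 ∈ Ng) :
    IsDeviationDynamics (actL P.A) P.stateGain P.cstr ((actL P.Hz).comp (actL P.C)) κ
      (max (Lf + ‖actL P.Gu‖ * Lg * ‖actL P.Gu‖) (‖actL P.Gu‖ * Lg * ‖actL P.C‖)) τp τd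
      (s - (P.steadyState w u, u, μ)) ((primalDual P τp τd).loopField P w s)
      (P.costGrad w s.2.1 - P.costGrad w u)
      ((actL P.Gu).adjoint
        (∇ P.g₀ (P.plantOutput w s.1 s.2.1) - ∇ P.g₀ (P.steadyOutput w s.2.1))) := by
  have hx : (s.1 - P.steadyState w u) + P.stateGain (s.2.1 - u) = s.1 - P.steadyState w s.2.1 :=
    (P.sub_steadyState w s.1 s.2.1 u).symm
  have hgy := norm_adjoint_gradient_sub_le (P := P) hg hsy hsz
  rw [primalDual_loopField]
  constructor <;> simp only [Prod.fst_sub, Prod.snd_sub, hx]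
  · exact stateField_eq hA w s.1 s.2.1
  · rw [smul_inv_smul₀ hτp, map_sub, map_sub, eq_neg_of_add_eq_zero_right hkkt.stationary, costGrad]
    abel
  · rw [smul_inv_smul₀ hτd, violation_plantOutput, map_sub P.cstr,
      eq_neg_of_add_eq_zero_left hkkt.feasible, sub_neg_eq_add]
  · exact hmono _ hs _ hkkt.mem
  · exact (norm_costGrad_sub_le hf hg hsu hu hsz hz).trans (by gcongr; exact le_max_left _ _)
  · calc _ ≤ ‖actL P.Gu‖ * (Lg * ‖P.plantOutput w s.1 s.2.1 - P.steadyOutput w s.2.1‖) := hgy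
      _ ≤ ‖actL P.Gu‖ * (Lg * (‖actL P.C‖ * ‖s.1 - P.steadyState w s.2.1‖)) := by
        rw [plantOutput_eq, add_sub_cancel_left]
        gcongr
        exact (actL P.C).le_opNorm _
      _ = (‖actL P.Gu‖ * Lg * ‖actL P.C‖) * ‖s.1 - P.steadyState w s.2.1‖ := by ring
      _ ≤ _ := by gcongr; exact le_max_right _ _

end LocalEstimates

theorem exists_forall_primalDual_isLocallyExpStable (hA : IsHurwitz P.A) (hκ : 0 < κ)
    (hsurj : Function.Surjective P.cstr) {W : Set (Vec nw)} {ub : Vec nw → Vec m}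
    {μb : Vec nw → Vec nc} {Lf Lg : ℝ≥0} {ρ : ℝ} (hρ : 0 < ρ)
    (hmono : ∀ w ∈ W, StronglyMonotoneOn (P.interiorInputs w) κ (P.costGrad w))
    (hf : ∀ w ∈ W, LipschitzOnWith Lf (∇ P.f₀) (ball (ub w) ρ))
    (hg : ∀ w ∈ W, LipschitzOnWith Lg (∇ P.g₀) (ball (P.steadyOutput w (ub w)) ρ))
    (hkkt : ∀ w ∈ W, P.IsKKT w (ub w) (μb w)) :
    ∃ τ > 0, ∀ τp τd, τ < τp → τ < τd → ∀ w ∈ W,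
      IsLocallyExpStable ((primalDual P τp τd).loopField P w)
        ((primalDual P τp τd).loopDomain P w) (P.steadyState w (ub w), ub w, μb w) := by
  obtain ⟨Θ, k, hk, hΘ⟩ := hA.exists_isLyapunovOperator
  obtain ⟨σ, hσ, hM⟩ := exists_mul_norm_sq_le_norm_adjoint_sq hsurj
  obtain ⟨τ, hτ, hstable⟩ := exists_forall_isLocallyExpStable hk hκ hσ hΘ P.stateGain hM
    ((actL P.Hz).comp (actL P.C))
    (max (Lf + ‖actL P.Gu‖ * Lg * ‖actL P.Gu‖) (‖actL P.Gu‖ * Lg * ‖actL P.C‖))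
  refine ⟨τ, hτ, fun τp τd hτp hτd w hw => ?_⟩
  have hp₀ : 0 < τp := hτ.trans hτp
  have hd₀ : 0 < τd := hτ.trans hτd
  obtain ⟨hu, hz⟩ := (hkkt w hw).mem
  have hnear := eventually_mem_near_steadyState (P := P) (μ := μb w)
    (inter_mem (isOpen_interior.mem_nhds hu) (ball_mem_nhds _ hρ))
    (inter_mem (isOpen_interior.mem_nhds hz) (ball_mem_nhds _ hρ))
  obtain ⟨R, hR, hball⟩ := nhds_basis_closedBall.eventually_iff.1 hnear
  obtain ⟨K, hK⟩ := primalDual_lipschitzOnWith (τp := τp) (τd := τd) (hf w hw) (hg w hw)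
    (fun s hs => (hball hs).1.2) (fun s hs => (hball hs).2.2.2)
  refine hstable τp τd hτp hτd _ _ _
    ((primalDual_isEquilibrium_iff hA hp₀ hd₀).2 ⟨rfl, hkkt w hw⟩) R hR
    (fun s hs => ⟨(hball hs).1.1, (hball hs).2.2.1⟩) K hK fun s hs => ?_
  obtain ⟨⟨hsU, hsf⟩, ⟨hsZ, hsg⟩, -, hsy⟩ := hball hs
  exact ⟨_, _, primalDual_isDeviationDynamics hA hp₀.ne' hd₀.ne' (hmono w hw) (hf w hw) (hg w hw)
    (hkkt w hw) (mem_ball_self hρ) (mem_ball_self hρ) ⟨hsU, hsZ⟩ hsf hsg hsy⟩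

end PrimalDual

end OSS

theorem mainTheorem4_general {n m r nw nc : ℕ} (P : OSS.Problem n m r nw nc)
    (hA : OSS.IsHurwitz P.A) (hW : IsCompact P.W)
    (hf : DifferentiableOn ℝ P.f₀ (interior P.U)) (hg : DifferentiableOn ℝ P.g₀ (interior P.Z))
    (hf' : LocallyLipschitzOn (interior P.U) (gradient P.f₀))
    (hg' : LocallyLipschitzOn (interior P.Z) (gradient P.g₀))
    (hopt : ∀ w ∈ P.W, ∃ u ∈ interior P.U, ∃ z ∈ interior P.Z, P.IsOptimal w u z)
    (hconv : ∃ κ : ℝ, 0 < κ ∧ ∀ w ∈ P.W,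
      StrongConvexOn {u | u ∈ P.U ∧ P.steadyOutput w u ∈ P.Z} κ
        (fun u => P.f₀ u + P.g₀ (P.steadyOutput w u)))
    (hrank : (P.Hz * P.Gu + P.Hu).rank = nc) :
    ∃ τs : ℝ, 0 < τs ∧ ∀ τp τd : ℝ, τs < τp → τs < τd →
      (OSS.primalDual P τp τd).SolvesOSS P := by
  obtain ⟨κ, hκ, hconv⟩ := hconv
  have hsurj := OSS.Problem.cstr_surjective hrank
  have hmono := fun w hw => OSS.Problem.stronglyMonotoneOn_costGrad hf hg (hconv w hw)
  choose! ub μb hub hkkt using fun w hw => OSS.Problem.exists_isOptimal_and_isKKT hf hg (hopt w hw)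
  have hcont := OSS.Problem.continuousOn_of_isKKT hκ hsurj hmono hf'.continuousOn
    hg'.continuousOn hkkt
  obtain ⟨Lf, Lg, ρ, hρ, hLip⟩ := OSS.Problem.exists_lipschitzOnWith_gradient_ball hW hcont
    (fun w hw => (hkkt w hw).mem) hf' hg'
  obtain ⟨τ, hτ, hstable⟩ := OSS.exists_forall_primalDual_isLocallyExpStable hA hκ hsurj hρ hmono
    (fun w hw => (hLip w hw).1) (fun w hw => (hLip w hw).2) hkkt
  refine ⟨τ, hτ, fun τp τd hτp hτd w hw => ⟨_, hstable τp τd hτp hτd w hw, fun q hq => ?_, ?_⟩⟩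
  · exact OSS.eq_of_primalDual_isEquilibrium hA (hτ.trans hτp) (hτ.trans hτd) hκ hsurj (hmono w hw)
      hq (hkkt w hw)
  · change P.IsOptimal w (ub w) (P.plantOutput w (P.steadyState w (ub w)) (ub w))
    exact (P.plantOutput_steadyState w (ub w)).symm ▸ hub w hw

theorem mainTheorem4 {n m r nw nc : ℕ} (P : OSS.Problem n m r nw nc) (hP : P.Standing)
    (hconv : ∃ κ : ℝ, 0 < κ ∧ ∀ w ∈ P.W,
      StrongConvexOn {u | u ∈ P.U ∧ P.steadyOutput w u ∈ P.Z} κ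
        (fun u => P.f₀ u + P.g₀ (P.steadyOutput w u)))
    (hrank : (P.Hz * P.Gu + P.Hu).rank = nc) :
    ∃ τs : ℝ, 0 < τs ∧ ∀ τp τd : ℝ, τs < τp → τs < τd →
      (OSS.primalDual P τp τd).SolvesOSS P :=
  mainTheorem4_general P hP.hurwitz hP.compact_W (hP.contDiff_f₀.differentiableOn one_ne_zero)
    (hP.contDiff_g₀.differentiableOn one_ne_zero) hP.locLip_f₀ hP.locLip_g₀ hP.optimal hconv hrank
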